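/- \textbf{Theorem (capacity region under Purify-and-Swap).} A quantum switch serves $K$ end users; let $E=\{(i,j):1\le i<j\le K\}$. In every time slot $\alpha_{max}$ attempts are made on each link $i$ to create a link-level entanglement, each successful with probability $p_i$, so that the number $T_i$ of entanglements created is binomial, $P_{T_i}(a)=\binom{\alpha_{max}}{a}p_i^{a}(1-p_i)^{\alpha_{max}-a}$. The $T_i$ entanglements of link $i$ are then purified; given $T_i=x$, the number $\tilde T_i\le x$ of purified entanglements has the conditional yield distribution $P_{Y|X}(\cdot\,|\,x)$ of the purification protocol (the initial fidelity $F$ and the target fidelity $F^{th}$ enter only through $P_{Y|X}$). Links and slots are independent, hence $$P_{\tilde T_i}(\tilde a_i)=\sum_{a=\tilde a_i}^{\alpha_{max}}P_{Y|X}(\tilde a_i|a)\,P_{T_i}(a),\qquad P_{\tilde T}(\tilde a)=\prod_{i=1}^K P_{\tilde T_i}(\tilde a_i),\qquad \tilde a\in\mathcal A=\{0,\dots,\alpha_{max}\}^K .$$ For $\tilde a\in\mathcal A$ let $\Pi(\tilde a)$ be the set of swap allocations $\pi=(\pi_{ij})_{(i,j)\in E}$ of non-negative integers with $\sum_i\pi_{ij}\le\tilde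 a_j$ for every user $j$, where $\pi_{ji}=\pi_{ij}$ and $\pi_{jj}=0$. In slot $n$ a scheduling policy observes the vector $\tilde Q(n)$ of queue lengths of pending requests and the vector $\tilde T(n)$ and selects, possibly at random, an allocation $\tilde W(n)\in\Pi(\tilde T(n))$, by a rule that depends only on $(\tilde Q(n),\tilde T(n))$. For each pair $(i,j)$, $\min\{\tilde W_{ij}(n),\tilde Q_{ij}(n)\}$ swaps are attempted, each independently successful with probability $q_{ij}$; the number of successes is $\tilde D_{ij}(n)$, and $\tilde Q_{ij}(n+1)=\tilde Q_{ij}(n)-\tilde D_{ij}(n)+A_{ij}(n)$. Here the arrivals $A_{ij}(n)$ are independent over pairs and slots, identically distributed over slots, with $\mathbb E[A_{ij}(n)]=\lambda_{ij}$ and $\mathbb E[A_{ij}(n)^2]<\infty$. The switch is stable under a policy if $\tilde Q(n)$ converges in distribution, as $n\to\infty$, to a limit that does not depend on the initial state and has a finite mean. The capacity region $\Lambda^{PS}$ is the set of rate vectors $\lambda\ge 0$ such that, for all arrival laws as above with rates $\lambda$, some policy makes the switch stable. Assume that $q_{ij}>0$ for all $(i,j)\in E$ and that $\Pr[\tilde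 T_i\ge 1]>0$ for every $i$. Then $$\Lambda^{PS}=\Big\{\lambda\in[0,\infty)^{E}:\ \exists\, (b_{\tilde a,\pi})_{\tilde a\in\mathcal A,\,\pi\in\Pi(\tilde a)}\ \text{with}\ b_{\tilde a,\pi}>0,\ \sum_{\pi\in\Pi(\tilde a)}b_{\tilde a,\pi}<1\ \ \forall\tilde a\in\mathcal A,\ \text{and}\ \lambda_{ij}\le\sum_{\tilde a\in\mathcal A,\ \tilde a\ne 0}P_{\tilde T}(\tilde a)\sum_{\pi\in\Pi(\tilde a)}b_{\tilde a,\pi}\,q_{ij}\pi_{ij}\ \ \forall (i,j)\in E\Big\}.$$ Moreover stabilizability depends on the arrivals only through their rates: for every choice of arrival laws as above with rates $\lambda$, some policy makes the switch stable if and only if $\lambda\in\Lambda^{PS}$. -/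

import Mathlib

open MeasureTheory Filter Topology

noncomputable section

namespace QuantumSwitch

/-- The joint law of independent `ℕ`-valued random variables with laws `f i`. -/
def piPMF {ι : Type*} [Fintype ι] (f : ι → PMF ℕ) : PMF (ι → ℕ) :=
  (Measure.pi fun i => (f i).toMeasure).toPMF

theorem piPMF_apply {ι : Type*} [Fintype ι] (f : ι → PMF ℕ) (x : ι → ℕ) :
    piPMF f x = ∏ i, f i (x i) := by
  simp [piPMF, Measure.toPMF_apply, Measure.pi_singleton, PMF.toMeasure_apply_singleton]

/-- The binomial law with `n` trials and success probability `p`. -/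
def binomialPMF (n : ℕ) (p : unitInterval) : PMF ℕ :=
  (ProbabilityTheory.binomial n p).toPMF

/-- The pairs `(i, j)` of end users with `i < j`. -/
abbrev UserPair (K : ℕ) : Type := {e : Fin K × Fin K // e.1 < e.2}

/-- The number of link-level entanglements of user `j` that the swap allocation `π` consumes:
the sum of `π` over all pairs that contain `j`. -/
def linkUse {K : ℕ} (π : UserPair K → ℕ) (j : Fin K) : ℕ :=
  ∑ e : UserPair K with (e.1.1 = j ∨ e.1.2 = j), π e

/-- The finite set of the swap allocations `π` that are feasible when `a j` (purified) link-level
entanglements are available at user `j`; see `mem_allocations`. -/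
def allocations {K : ℕ} (a : Fin K → ℕ) : Finset (UserPair K → ℕ) :=
  (Fintype.piFinset fun e : UserPair K => Finset.range (a e.1.1 + 1)).filter
    fun π => ∀ j, linkUse π j ≤ a j

theorem mem_allocations {K : ℕ} (a : Fin K → ℕ) (π : UserPair K → ℕ) :
    π ∈ allocations a ↔ ∀ j, linkUse π j ≤ a j := by
  simp only [allocations, Finset.mem_filter, Fintype.mem_piFinset, Finset.mem_range,
    and_iff_right_iff_imp]
  intro h e
  refine Nat.lt_succ_of_le (le_trans ?_ (h e.1.1))
  exact Finset.single_le_sum (f := π) (fun _ _ => Nat.zero_le _)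
    (Finset.mem_filter.2 ⟨Finset.mem_univ e, Or.inl rfl⟩)

/-- The data of a switch that serves `K` end users and purifies link-level entanglements. -/
structure Switch (K : ℕ) where
  /-- number of attempts per slot to create an entanglement on each link -/
  alphaMax : ℕ
  /-- success probability of one attempt on the link of user `i` -/
  p : Fin K → unitInterval
  /-- success probability of one entanglement swap between the users of a pair -/
  q : UserPair K → unitInterval
  /-- conditional yield distribution: `yield x` is the law of the number of output pairs when
  `x` pairs are submitted to the purification routine -/
  yield : ℕ → PMF ℕ
  /-- purification does not increase the number of pairs -/
  yield_le : ∀ x y, yield x y ≠ 0 → y ≤ x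

/-- The mean vector of the request arrivals is `lam`, and their second moments are finite.
Here `A e` is the law of the number of requests for the pair `e` that arrive in one slot. -/
structure IsArrivalLaw {K : ℕ} (A : UserPair K → PMF ℕ) (lam : UserPair K → ℝ) : Prop where
  mean : ∀ e, HasSum (fun k : ℕ => (k : ℝ) * (A e k).toReal) (lam e)
  second_moment : ∀ e, Summable fun k : ℕ => (k : ℝ) ^ 2 * (A e k).toReal

/-- A (possibly randomized) stationary scheduling policy: given the queue lengths and the numbers
of available purified link-level entanglements it draws a feasible swap allocation. -/
structure Policy (K : ℕ) where
  select : (UserPair K → ℕ) → (Fin K → ℕ) → PMF (UserPair K → ℕ)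
  feasible : ∀ Q a, ∀ π ∈ (select Q a).support, π ∈ allocations a

namespace Switch

variable {K : ℕ}

/-- The finite set of vectors of numbers of entanglements per link, `{0, …, alphaMax} ^ K`. -/
def linkStates (S : Switch K) : Finset (Fin K → ℕ) :=
  Fintype.piFinset fun _ => Finset.range (S.alphaMax + 1)

/-- The probability that `x` entanglements are created on the link of user `i` in one slot. -/
def linkProb (S : Switch K) (i : Fin K) (x : ℕ) : ℝ :=
  (S.alphaMax.choose x : ℝ) * (S.p i : ℝ) ^ x * (1 - (S.p i : ℝ)) ^ (S.alphaMax - x)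

/-- The probability that `y` purified entanglements are available on the link of user `i`. -/
def purifiedLinkProb (S : Switch K) (i : Fin K) (y : ℕ) : ℝ :=
  ∑ x ∈ Finset.Icc y S.alphaMax, (S.yield x y).toReal * S.linkProb i x

/-- The joint probability of the numbers `a i` of purified entanglements on the links. -/
def purifiedProb (S : Switch K) (a : Fin K → ℕ) : ℝ :=
  ∏ i, S.purifiedLinkProb i (a i)

/-- The random numbers of purified entanglements in one slot: on each link, independently,
a binomial number of entanglements is created and then purified. -/
def purifiedLaw (S : Switch K) : PMF (Fin K → ℕ) :=
  piPMF fun i => (binomialPMF S.alphaMax (S.p i)).bind S.yield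

/-- The law of the queue lengths in the next slot when they are `Q` in the current slot: the link
entanglements are created and purified, the policy selects `W`, for each pair `e` one attempts
`min (W e) (Q e)` swaps, each of which succeeds independently with probability `q e` and serves
one request, and new requests arrive. -/
def step (S : Switch K) (A : UserPair K → PMF ℕ) (μ : Policy K) (Q : UserPair K → ℕ) :
    PMF (UserPair K → ℕ) :=
  S.purifiedLaw.bind fun t =>
    (μ.select Q t).bind fun W =>
      (piPMF fun e => binomialPMF (min (W e) (Q e)) (S.q e)).bind fun D =>
        (piPMF A).map fun arrivals => fun e => Q e - D e + arrivals e

/-- The law of the queue lengths in slot `n` when they are `x` in slot `0`. -/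
def queueLaw (S : Switch K) (A : UserPair K → PMF ℕ) (μ : Policy K) (x : UserPair K → ℕ) :
    ℕ → PMF (UserPair K → ℕ)
  | 0 => PMF.pure x
  | n + 1 => (queueLaw S A μ x n).bind (S.step A μ)

/-- `queueLaw` as a point of the space of probability measures with its weak topology. -/
def queueDist (S : Switch K) (A : UserPair K → PMF ℕ) (μ : Policy K) (x : UserPair K → ℕ)
    (n : ℕ) : ProbabilityMeasure (UserPair K → ℕ) :=
  ⟨(S.queueLaw A μ x n).toMeasure, inferInstance⟩

/-- Stability under a policy: from every initial condition the queue lengths converge in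
distribution to one and the same limit, and this limit has a finite mean. -/
def IsStable (S : Switch K) (A : UserPair K → PMF ℕ) (μ : Policy K) : Prop :=
  ∃ ν : ProbabilityMeasure (UserPair K → ℕ),
    (∀ x, Tendsto (S.queueDist A μ x) atTop (𝓝 ν)) ∧
    ∀ e, Integrable (fun Q : UserPair K → ℕ => (Q e : ℝ)) (ν : Measure (UserPair K → ℕ))

/-- Some scheduling policy stabilizes the switch under the arrival laws `A`. -/
def Stabilizable (S : Switch K) (A : UserPair K → PMF ℕ) : Prop :=
  ∃ μ : Policy K, S.IsStable A μ

/-- The capacity region: the vectors of request rates for which the switch can be stabilized,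
whatever the laws (with finite second moments) of the arrivals with these rates are. -/
def capacityRegion (S : Switch K) : Set (UserPair K → ℝ) :=
  {lam | 0 ≤ lam ∧ ∀ A : UserPair K → PMF ℕ, IsArrivalLaw A lam → S.Stabilizable A}

end Switch

end QuantumSwitch

end

noncomputable section

namespace QuantumSwitch

open scoped ENNReal

/-! ### Expectations of nonnegative functions -/

/-! Everything is reduced to `interiorRates`, the rate vectors strictly below the service rates of a
randomized allocation rule with weights of sum one in each link state. Rescaling positive weights of
sum below one to sum one strictly raises every rate, since some link state of positive probability
has an entanglement at every user; conversely, slack in the rates leaves room to make all weights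
positive and their sums smaller than one (`mem_interiorRates_iff`). It remains to show that a switch
is stabilizable exactly when its arrival rates lie in this set.

Sufficiency (`stabilizable_of_lt_serviceRate`). The policy draws its allocation from the weights and
ignores the queues, so each queue is a Markov chain by itself with negative drift, and a quadratic
Lyapunov function bounds its mean length. Irreducibility and aperiodicity are not available for
arbitrary arrival laws, so convergence is obtained by coupling. Let two networks driven by the same
randomness differ by one request, served last in its queue. They coalesce once a slot has a spare,
successful swap for that request. The probability that this has not happened after `n` slots is an
iterate of `killedOp` and tends to zero, because bounded means keep returning the queue to low
levels, from which coalescence is possible. Loss of memory together with tightness yields a limit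
law (`exists_limit_pmf`).

Necessity (`IsStable.lt_expect_maxService`). If the rates lie outside the open convex set
`interiorRates`, Hahn-Banach gives nonzero weights `w ≥ 0` for which the weighted queue length has
nonnegative drift under every policy. The limit law is stationary with finite mean, so this drift
vanishes on its support. The delicate case is a critically loaded deterministic system, which can
have a stationary law. By Dickson's lemma the weight attains a minimum on the support; the states of
minimal weight are closed under the dynamics, so there weighted services balance weighted arrivals
in every outcome. Consequently arrivals have constant weight, and the weighted pairs with random
swaps are never served and receive nothing. A heavier initial state in which those pairs are empty
can then never lose weight, hence never reaches the minimal states, although the limit law charges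
them: the limit would depend on the initial state. -/

/-- The expectation of an extended nonnegative function under a probability mass function. -/
def expect {α : Type*} (p : PMF α) (g : α → ℝ≥0∞) : ℝ≥0∞ := ∑' a, p a * g a

section Expect

variable {α β : Type*}

theorem expect_pure (a : α) (g : α → ℝ≥0∞) : expect (PMF.pure a) g = g a := by
  rw [expect, tsum_eq_single a]
  · simp
  · intro b hb
    simp [PMF.pure_apply, hb]

theorem expect_bind (p : PMF α) (k : α → PMF β) (g : β → ℝ≥0∞) :
    expect (p.bind k) g = expect p fun a => expect (k a) g := by
  simp only [expect, PMF.bind_apply, ← ENNReal.tsum_mul_right, ← ENNReal.tsum_mul_left]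
  rw [ENNReal.tsum_comm]
  simp only [mul_assoc]

theorem expect_map (p : PMF α) (f : α → β) (g : β → ℝ≥0∞) :
    expect (p.map f) g = expect p fun a => g (f a) := by
  rw [PMF.map, expect_bind]
  simp only [Function.comp_apply, expect_pure]

theorem expect_mono_of_support {p : PMF α} {f g : α → ℝ≥0∞} (h : ∀ a, p a ≠ 0 → f a ≤ g a) :
    expect p f ≤ expect p g := by
  refine ENNReal.tsum_le_tsum fun a => ?_
  by_cases ha : p a = 0
  · simp [ha]
  · exact mul_le_mul_right (h a ha) _

theorem expect_mono {p : PMF α} {f g : α → ℝ≥0∞} (h : ∀ a, f a ≤ g a) :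
    expect p f ≤ expect p g :=
  expect_mono_of_support fun a _ => h a

theorem expect_congr {p : PMF α} {f g : α → ℝ≥0∞} (h : ∀ a, p a ≠ 0 → f a = g a) :
    expect p f = expect p g :=
  le_antisymm (expect_mono_of_support fun a ha => (h a ha).le)
    (expect_mono_of_support fun a ha => (h a ha).ge)

theorem expect_add (p : PMF α) (f g : α → ℝ≥0∞) :
    expect p (fun a => f a + g a) = expect p f + expect p g := by
  simp only [expect, mul_add, ENNReal.tsum_add]

theorem expect_const_mul (p : PMF α) (c : ℝ≥0∞) (g : α → ℝ≥0∞) :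
    expect p (fun a => c * g a) = c * expect p g := by
  simp only [expect, ← ENNReal.tsum_mul_left, mul_left_comm]

theorem expect_const (p : PMF α) (c : ℝ≥0∞) : expect p (fun _ => c) = c := by
  simp [expect, ENNReal.tsum_mul_right]

theorem expect_finset_sum {ι : Type*} (p : PMF α) (s : Finset ι) (f : ι → α → ℝ≥0∞) :
    expect p (fun a => ∑ i ∈ s, f i a) = ∑ i ∈ s, expect p (f i) := by
  classical
  induction s using Finset.induction_on with
  | empty => simp [expect]
  | insert i s hi ih => simp only [Finset.sum_insert hi, expect_add, ih]

theorem mul_le_expect (p : PMF α) (g : α → ℝ≥0∞) (a : α) : p a * g a ≤ expect p g :=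
  ENNReal.le_tsum (f := fun a => p a * g a) a

theorem expect_le_const {p : PMF α} {g : α → ℝ≥0∞} {c : ℝ≥0∞} (h : ∀ a, p a ≠ 0 → g a ≤ c) :
    expect p g ≤ c :=
  (expect_mono_of_support h).trans_eq (expect_const p c)

theorem const_le_expect {p : PMF α} {g : α → ℝ≥0∞} {c : ℝ≥0∞} (h : ∀ a, p a ≠ 0 → c ≤ g a) :
    c ≤ expect p g :=
  (expect_const p c).ge.trans (expect_mono_of_support h)

/-- A nonnegative function that dominates a constant on the support and has that constant as its
expectation agrees with the constant on the support. -/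
theorem eq_of_expect_le {p : PMF α} {f g : α → ℝ≥0∞} (hf : expect p f ≠ ∞)
    (h : ∀ a, p a ≠ 0 → f a ≤ g a) (hle : expect p g ≤ expect p f) {a : α} (ha : p a ≠ 0) :
    g a = f a := by
  refine le_antisymm ?_ (h a ha)
  by_contra hlt
  rw [not_le] at hlt
  refine absurd hle (not_le.2 ?_)
  refine ENNReal.tsum_lt_tsum (i := a) hf (fun b => ?_) ?_
  · by_cases hb : p b = 0
    · simp [hb]
    · exact mul_le_mul_right (h b hb) _
  · exact ENNReal.mul_lt_mul_right ha (p.apply_ne_top a) hlt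

theorem bind_apply_ne_zero {p : PMF α} {k : α → PMF β} {a : α} {b : β} (ha : p a ≠ 0)
    (hb : k a b ≠ 0) : p.bind k b ≠ 0 :=
  (PMF.mem_support_bind_iff p k b).2 ⟨a, ha, hb⟩

theorem map_apply_ne_zero {p : PMF α} (f : α → β) {a : α} (ha : p a ≠ 0) :
    p.map f (f a) ≠ 0 :=
  (PMF.mem_support_map_iff f p (f a)).2 ⟨a, ha, rfl⟩

end Expect

/-! ### Products of laws on the natural numbers -/

section Pi

variable {ι : Type*} [Fintype ι]

/-- Independence in the form used throughout: mass functions of compositions and marginals of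
product laws are themselves expectations of products. -/
theorem expect_piPMF_prod (f : ι → PMF ℕ) (h : ι → ℕ → ℝ≥0∞) :
    expect (piPMF f) (fun x => ∏ i, h i (x i)) = ∏ i, expect (f i) (h i) := by
  have key := ProbabilityTheory.lintegral_prod_eq_prod_lintegral_of_indepFun
    (μ := Measure.pi fun i => (f i).toMeasure) Finset.univ (fun i x => h i (x i))
    (ProbabilityTheory.iIndepFun_pi (X := fun i => h i)
      fun i => (measurable_of_countable (h i)).aemeasurable)
    (fun i => (measurable_of_countable (h i)).comp (measurable_pi_apply i))
  have h1 : ∀ i, ∫⁻ x, h i (x i) ∂(Measure.pi fun i => (f i).toMeasure)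
      = expect (f i) (h i) := by
    intro i
    have := (measurePreserving_eval (fun i => (f i).toMeasure) i).lintegral_comp
      (measurable_of_countable (h i))
    simp only [Function.eval] at this
    rw [this, lintegral_countable']
    simp [expect, PMF.toMeasure_apply_singleton, mul_comm]
  simp only [h1] at key
  rw [← key, lintegral_countable']
  simp only [expect, piPMF, Measure.toPMF_apply, mul_comm]

theorem piPMF_bind (f : ι → PMF ℕ) (k : ι → ℕ → PMF ℕ) :
    ((piPMF f).bind fun y => piPMF fun i => k i (y i)) = piPMF fun i => (f i).bind (k i) := by
  ext z
  have := expect_piPMF_prod f fun i y => k i y (z i)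
  simpa only [expect, piPMF_apply, PMF.bind_apply] using this

theorem expect_piPMF_eval (f : ι → PMF ℕ) (i : ι) (g : ℕ → ℝ≥0∞) :
    expect (piPMF f) (fun x => g (x i)) = expect (f i) g := by
  classical
  have := expect_piPMF_prod f fun j => if j = i then g else fun _ => 1
  have h1 : ∀ x : ι → ℕ, ∏ j, (if j = i then g else fun _ => 1) (x j) = g (x i) := by
    intro x
    rw [Finset.prod_eq_single i] <;> simp +contextual
  simp only [h1] at this
  rw [this, Finset.prod_eq_single i]
  · simp
  · intro j _ hj
    simp [hj, expect_const]
  · simp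

theorem piPMF_pure (y : ι → ℕ) : (piPMF fun i => PMF.pure (y i)) = PMF.pure y := by
  classical
  ext z
  rw [piPMF_apply]
  by_cases h : z = y
  · subst h; simp
  · obtain ⟨i, hi⟩ := Function.ne_iff.1 h
    rw [PMF.pure_apply_of_ne _ _ h, Finset.prod_eq_zero (Finset.mem_univ i)]
    exact PMF.pure_apply_of_ne _ _ hi

theorem piPMF_map (f : ι → PMF ℕ) (φ : ι → ℕ → ℕ) :
    ((piPMF f).map fun y i => φ i (y i)) = piPMF fun i => (f i).map (φ i) := by
  have := piPMF_bind f fun i y => PMF.pure (φ i y)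
  simp only [piPMF_pure fun i => φ i _] at this
  exact this

theorem piPMF_update [DecidableEq ι] (y : ι → ℕ) (i : ι) (c : PMF ℕ) :
    (piPMF fun j => if j = i then c else PMF.pure (y j)) = c.map (Function.update y i) := by
  have h := piPMF_map (fun j => if j = i then c else PMF.pure (y j)) fun _ n => n
  ext z
  rw [piPMF_apply, PMF.map_apply, Fintype.prod_eq_mul_prod_compl i, if_pos rfl]
  by_cases hz : ∀ j, j ≠ i → z j = y j
  · have hz' : z = Function.update y i (z i) := by
      funext j
      by_cases hj : j = i
      · subst hj; simp
      · simp [hj, hz j hj]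
    rw [Finset.prod_eq_one, mul_one, tsum_eq_single (z i)]
    · rw [if_pos hz']
    · intro b hb
      rw [if_neg]
      intro h
      exact hb (by rw [h]; simp)
    · intro j hj
      have hj : j ≠ i := by simpa using hj
      rw [if_neg hj, hz j hj, PMF.pure_apply_self]
  · push Not at hz
    obtain ⟨j, hj, hne⟩ := hz
    rw [Finset.prod_eq_zero (i := j) (by simpa using hj), mul_zero]
    · refine (ENNReal.tsum_eq_zero.2 fun b => if_neg ?_).symm
      intro h
      exact hne (by rw [h]; simp [hj])
    · rw [if_neg hj, PMF.pure_apply_of_ne _ _ hne]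

theorem piPMF_apply_ne_zero {f : ι → PMF ℕ} {x : ι → ℕ} :
    piPMF f x ≠ 0 ↔ ∀ i, f i (x i) ≠ 0 := by
  simp [piPMF_apply, Finset.prod_ne_zero_iff]

end Pi

/-! ### Binomial laws -/

section Binomial

theorem binomialPMF_apply (n : ℕ) (p : unitInterval) (k : ℕ) :
    binomialPMF n p k = ENNReal.ofReal ((n.choose k) * (p : ℝ) ^ k * (1 - (p : ℝ)) ^ (n - k)) := by
  rw [binomialPMF, Measure.toPMF_apply, ProbabilityTheory.binomial_singleton]

theorem le_of_binomialPMF_ne_zero {n k : ℕ} {p : unitInterval} (h : binomialPMF n p k ≠ 0) :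
    k ≤ n := by
  by_contra hk
  rw [binomialPMF_apply, Nat.choose_eq_zero_of_lt (not_le.1 hk)] at h
  simp at h

theorem binomialPMF_apply_self (n : ℕ) (p : unitInterval) :
    binomialPMF n p n = ENNReal.ofReal (p : ℝ) ^ n := by
  rw [binomialPMF_apply, ← ENNReal.ofReal_pow p.2.1]
  simp

theorem binomialPMF_apply_zero (n : ℕ) (p : unitInterval) :
    binomialPMF n p 0 = ENNReal.ofReal (1 - (p : ℝ)) ^ n := by
  rw [binomialPMF_apply, ← ENNReal.ofReal_pow (sub_nonneg.2 p.2.2)]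
  simp

theorem binomialPMF_zero (p : unitInterval) : binomialPMF 0 p = PMF.pure 0 := by
  ext k
  rcases k with _ | k
  · simp [binomialPMF_apply]
  · simp [binomialPMF_apply, PMF.pure_apply]

theorem binomialPMF_one_expect (p : unitInterval) (g : ℕ → ℝ≥0∞) :
    expect (binomialPMF 1 p) g
      = ENNReal.ofReal (1 - (p : ℝ)) * g 0 + ENNReal.ofReal (p : ℝ) * g 1 := by
  rw [expect, tsum_eq_sum (s := Finset.range 2)]
  · simp [Finset.sum_range_succ, binomialPMF_apply]
  · intro b hb
    have : binomialPMF 1 p b = 0 := by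
      by_contra h
      have := le_of_binomialPMF_ne_zero h
      simp at hb
      omega
    rw [this, zero_mul]

/-- Splitting off one trial is what later isolates the service of one additional request. -/
theorem binomialPMF_succ (n : ℕ) (p : unitInterval) :
    binomialPMF (n + 1) p
      = (binomialPMF n p).bind fun d => (binomialPMF 1 p).map fun s => d + s := by
  have hp0 := p.2.1
  have hp1 := sub_nonneg.2 p.2.2
  ext k
  have h2 : ∀ d : ℕ, ((binomialPMF 1 p).map fun s => d + s) k
      = ENNReal.ofReal (1 - (p : ℝ)) * (if d = k then 1 else 0)
        + ENNReal.ofReal (p : ℝ) * (if d + 1 = k then 1 else 0) := by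
    intro d
    have := binomialPMF_one_expect p fun s => if d + s = k then 1 else 0
    rw [add_zero] at this
    rw [← this, PMF.map_apply, expect]
    refine tsum_congr fun a => ?_
    by_cases h : k = d + a
    · simp [h]
    · simp [h, Ne.symm h]
  simp only [PMF.bind_apply, h2, mul_add, ENNReal.tsum_add]
  rw [tsum_eq_single k (by intro b hb; simp [hb])]
  rcases k with _ | k
  · simp only [Nat.add_eq_zero_iff, one_ne_zero, and_false, if_false, mul_zero, tsum_zero,
      add_zero, if_true, mul_one, binomialPMF_apply_zero, pow_succ]
  · rw [tsum_eq_single k (by intro b hb; simp [hb])]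
    simp only [if_true, mul_one]
    rw [binomialPMF_apply, binomialPMF_apply, binomialPMF_apply,
      ← ENNReal.ofReal_mul (by positivity), ← ENNReal.ofReal_mul (by positivity),
      ← ENNReal.ofReal_add (by positivity) (by positivity)]
    congr 1
    rcases lt_trichotomy n k with h | h | h
    · simp [Nat.choose_eq_zero_of_lt, h, Nat.lt_succ_of_lt h]
    · subst h
      simp [pow_succ]
    · obtain ⟨m, rfl⟩ := Nat.exists_eq_add_of_lt h
      have e1 : k + m + 1 + 1 - (k + 1) = m + 1 := by omega
      have e2 : k + m + 1 - (k + 1) = m := by omega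
      have e3 : k + m + 1 - k = m + 1 := by omega
      rw [e1, e2, e3, Nat.choose_succ_succ]
      push_cast
      ring

theorem binomialPMF_mean (n : ℕ) (p : unitInterval) :
    expect (binomialPMF n p) (fun d => (d : ℝ≥0∞)) = ENNReal.ofReal (p : ℝ) * n := by
  induction n with
  | zero => simp [binomialPMF_zero, expect_pure]
  | succ n ih =>
    have h1 : ENNReal.ofReal (1 - (p : ℝ)) + ENNReal.ofReal (p : ℝ) = 1 := by
      rw [← ENNReal.ofReal_add (sub_nonneg.2 p.2.2) p.2.1]
      simp
    have h2 : ∀ d : ℕ, ENNReal.ofReal (1 - (p : ℝ)) * ((d + 0 : ℕ) : ℝ≥0∞)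
        + ENNReal.ofReal (p : ℝ) * ((d + 1 : ℕ) : ℝ≥0∞) = d + ENNReal.ofReal (p : ℝ) := by
      intro d
      push_cast
      rw [add_zero, mul_add, ← add_assoc, ← add_mul, h1, one_mul, mul_one]
    rw [binomialPMF_succ, expect_bind]
    simp only [expect_map, binomialPMF_one_expect, h2]
    rw [expect_add, ih, expect_const]
    push_cast
    ring

end Binomial

theorem expect_comm {α β : Type*} (p : PMF α) (q : PMF β) (g : α → β → ℝ≥0∞) :
    expect p (fun a => expect q (g a)) = expect q fun b => expect p fun a => g a b := by
  simp only [expect, ← ENNReal.tsum_mul_left]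
  rw [ENNReal.tsum_comm]
  simp only [mul_left_comm]

theorem pmf_ext_expect {α : Type*} {p q : PMF α} (h : ∀ g, expect p g = expect q g) : p = q := by
  classical
  ext a
  have := h fun b => if b = a then 1 else 0
  simpa [expect] using this

/-! ### The averaging operator of a Markov kernel -/

section KernelOp

variable {α : Type*} (k : α → PMF α)

/-- The averaging operator of a Markov kernel on a discrete space. -/
def kernelOp (g : α → ℝ≥0∞) (x : α) : ℝ≥0∞ := expect (k x) g

theorem kernelOp_mono : Monotone (kernelOp k) := fun _ _ h _ => expect_mono h

theorem kernelOp_iterate_mono (n : ℕ) : Monotone ((kernelOp k)^[n]) :=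
  (kernelOp_mono k).iterate n

theorem kernelOp_const (c : ℝ≥0∞) : kernelOp k (fun _ => c) = fun _ => c :=
  funext fun x => expect_const (k x) c

theorem kernelOp_iterate_const (c : ℝ≥0∞) (n : ℕ) : (kernelOp k)^[n] (fun _ => c) = fun _ => c :=
  Function.iterate_fixed (kernelOp_const k c) n

theorem kernelOp_iterate_le_one {f : α → ℝ≥0∞} (hf : ∀ x, f x ≤ 1) (n : ℕ) (x : α) :
    (kernelOp k)^[n] f x ≤ 1 := by
  have := kernelOp_iterate_mono k n (show f ≤ fun _ => 1 from hf) x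
  rwa [kernelOp_iterate_const] at this

theorem kernelOp_iterate_add (n : ℕ) (f g : α → ℝ≥0∞) :
    (kernelOp k)^[n] (fun x => f x + g x)
      = fun x => (kernelOp k)^[n] f x + (kernelOp k)^[n] g x := by
  induction n with
  | zero => rfl
  | succ n ih =>
    simp only [Function.iterate_succ_apply', ih]
    exact funext fun x => expect_add _ _ _

theorem kernelOp_iterate_const_mul (n : ℕ) (c : ℝ≥0∞) (f : α → ℝ≥0∞) :
    (kernelOp k)^[n] (fun x => c * f x) = fun x => c * (kernelOp k)^[n] f x := by
  induction n with
  | zero => rfl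
  | succ n ih =>
    simp only [Function.iterate_succ_apply', ih]
    exact funext fun x => expect_const_mul _ _ _

theorem kernelOp_iterate_finset_sum {ι : Type*} (n : ℕ) (s : Finset ι) (f : ι → α → ℝ≥0∞) :
    (kernelOp k)^[n] (fun x => ∑ i ∈ s, f i x) = fun x => ∑ i ∈ s, (kernelOp k)^[n] (f i) x := by
  induction n with
  | zero => rfl
  | succ n ih =>
    simp only [Function.iterate_succ_apply', ih]
    exact funext fun x => expect_finset_sum _ _ _

end KernelOp

/-! ### A single queue -/

section Queue

/-- The law of the length of a queue in the next slot, when its current length is `x`, at most `w`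
services with success probability `q` are attempted, and the arrivals have the law `A`. -/
def serve (q : unitInterval) (A : PMF ℕ) (w x : ℕ) : PMF ℕ :=
  (binomialPMF (min w x) q).bind fun d => A.map fun a => x - d + a

/-- The probability that one additional request would be served at once when `w` services are
attempted and `x` requests are present. -/
def extraService (q : unitInterval) (w x : ℕ) : ℝ≥0∞ := if x < w then ENNReal.ofReal (q : ℝ) else 0

variable (q : unitInterval) (A : PMF ℕ)

theorem extraService_le_one (w x : ℕ) : extraService q w x ≤ 1 := by
  unfold extraService
  split_ifs
  · exact ENNReal.ofReal_le_one.2 q.2.2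
  · exact zero_le

theorem one_sub_add_extraService (w x : ℕ) : 1 - extraService q w x + extraService q w x = 1 :=
  tsub_add_cancel_of_le (extraService_le_one q w x)

theorem expect_serve (w x : ℕ) (g : ℕ → ℝ≥0∞) :
    expect (serve q A w x) g
      = expect (binomialPMF (min w x) q) fun d => expect A fun a => g (x - d + a) := by
  simp only [serve, expect_bind, expect_map]

theorem expect_binomialPMF_extra (w x : ℕ) (g : ℕ → ℝ≥0∞) :
    expect (binomialPMF (if x < w then 1 else 0) q) g
      = (1 - extraService q w x) * g 0 + extraService q w x * g 1 := by
  unfold extraService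
  split_ifs
  · rw [binomialPMF_one_expect, ENNReal.ofReal_sub _ q.2.1, ENNReal.ofReal_one]
  · simp [binomialPMF_zero, expect_pure]

/-- The coupling behind the whole sufficiency proof. The additional request stands last in line: it
adds one attempt exactly when `x < w`; otherwise all `w` attempts go to earlier requests and it
stays. -/
theorem serve_succ (w x : ℕ) :
    serve q A w (x + 1) = (serve q A w x).bind fun y =>
      (binomialPMF (if x < w then 1 else 0) q).map fun s => y + 1 - s := by
  refine pmf_ext_expect fun g => ?_
  simp only [expect_serve, expect_bind, expect_map]
  by_cases h : x < w
  · rw [if_pos h, min_eq_right (Nat.succ_le_of_lt h), min_eq_right h.le, binomialPMF_succ,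
      expect_bind]
    refine expect_congr fun d hd => ?_
    rw [expect_map, expect_comm]
    refine expect_congr fun a _ => expect_congr fun s hs => ?_
    have h1 := le_of_binomialPMF_ne_zero hd
    have h2 := le_of_binomialPMF_ne_zero hs
    congr 1
    omega
  · rw [if_neg h, min_eq_left (by omega), min_eq_left (by omega), binomialPMF_zero]
    refine expect_congr fun d hd => expect_congr fun a _ => ?_
    have h1 := le_of_binomialPMF_ne_zero hd
    rw [expect_pure]
    congr 1
    omega

theorem expect_serve_succ (w x : ℕ) (g : ℕ → ℝ≥0∞) :
    expect (serve q A w (x + 1)) g = expect (serve q A w x) fun y =>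
      (1 - extraService q w x) * g (y + 1) + extraService q w x * g y := by
  rw [serve_succ, expect_bind]
  simp only [expect_map, expect_binomialPMF_extra, Nat.sub_zero, Nat.add_sub_cancel]

variable (M : PMF ℕ)

/-- The transition law of a queue in which the numbers of attempted services have the law `M`. -/
def queueStep (x : ℕ) : PMF ℕ := M.bind fun w => serve q A w x

theorem kernelOp_queueStep (g : ℕ → ℝ≥0∞) (x : ℕ) :
    kernelOp (queueStep q A M) g x = expect M fun w => expect (serve q A w x) g := by
  rw [kernelOp, queueStep, expect_bind]

theorem kernelOp_queueStep_monotone {g : ℕ → ℝ≥0∞} (hg : Monotone g) :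
    Monotone (kernelOp (queueStep q A M) g) := by
  refine monotone_nat_of_le_succ fun x => ?_
  simp only [kernelOp_queueStep]
  refine expect_mono fun w => ?_
  rw [expect_serve_succ]
  refine expect_mono fun y => ?_
  calc g y = (1 - extraService q w x) * g y + extraService q w x * g y := by
        rw [← add_mul, one_sub_add_extraService, one_mul]
    _ ≤ _ := by gcongr; exact hg (Nat.le_succ y)

theorem kernelOp_queueStep_succ_le {g : ℕ → ℝ≥0∞} (h : ∀ x, g (x + 1) ≤ g x + 1) (x : ℕ) :
    kernelOp (queueStep q A M) g (x + 1) ≤ kernelOp (queueStep q A M) g x + 1 := by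
  simp only [kernelOp_queueStep]
  rw [← expect_const M 1, ← expect_add]
  refine expect_mono fun w => ?_
  have h1 : expect (serve q A w x) g + 1 = expect (serve q A w x) fun y => g y + 1 := by
    rw [expect_add, expect_const]
  rw [expect_serve_succ, h1]
  refine expect_mono fun y => ?_
  calc _ ≤ (1 - extraService q w x) * (g y + 1) + extraService q w x * (g y + 1) := by
        gcongr
        · exact h y
        · exact le_self_add
    _ = _ := by rw [← add_mul, one_sub_add_extraService, one_mul]

theorem iterate_queueStep_cast_monotone (n : ℕ) :
    Monotone ((kernelOp (queueStep q A M))^[n] fun x => (x : ℝ≥0∞)) := by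
  induction n with
  | zero => exact Nat.mono_cast
  | succ n ih =>
    rw [Function.iterate_succ_apply']
    exact kernelOp_queueStep_monotone q A M ih

theorem iterate_queueStep_cast_le (n x : ℕ) :
    (kernelOp (queueStep q A M))^[n] (fun x => (x : ℝ≥0∞)) x
      ≤ (kernelOp (queueStep q A M))^[n] (fun x => (x : ℝ≥0∞)) 0 + x := by
  have step : ∀ n x, (kernelOp (queueStep q A M))^[n] (fun x => (x : ℝ≥0∞)) (x + 1)
      ≤ (kernelOp (queueStep q A M))^[n] (fun x => (x : ℝ≥0∞)) x + 1 := by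
    intro n
    induction n with
    | zero => intro x; simp
    | succ n ih =>
      rw [Function.iterate_succ_apply']
      exact kernelOp_queueStep_succ_le q A M ih
  induction x with
  | zero => simp
  | succ x ih =>
    refine (step n x).trans ?_
    push_cast
    rw [← add_assoc]
    gcongr

/-- The empty queue is the smallest state: after one slot the chain is at some state above `0`, and
the mean after `n` further slots is monotone in the starting point. -/
theorem iterate_queueStep_cast_zero_mono :
    Monotone fun n => (kernelOp (queueStep q A M))^[n] (fun x => (x : ℝ≥0∞)) 0 := by
  refine monotone_nat_of_le_succ fun n => ?_
  rw [Function.iterate_succ_apply']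
  exact const_le_expect fun a _ => iterate_queueStep_cast_monotone q A M n (Nat.zero_le a)

variable {q A M}

/-- The quadratic drift of a queue. -/
theorem kernelOp_queueStep_sq_le {N : ℕ} (hN : ∀ w, M w ≠ 0 → w ≤ N) {ε : ℝ≥0∞}
    (hmean : expect A (fun a => (a : ℝ≥0∞)) ≠ ∞)
    (hε : expect A (fun a => (a : ℝ≥0∞)) + ε
      = ENNReal.ofReal (q : ℝ) * expect M fun w => (w : ℝ≥0∞)) (x : ℕ) :
    kernelOp (queueStep q A M) (fun x => (x : ℝ≥0∞) ^ 2) x + 2 * ε * x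
      ≤ (x : ℝ≥0∞) ^ 2 + (expect A (fun a => (a : ℝ≥0∞) ^ 2) + 3 * (N : ℝ≥0∞) ^ 2) := by
  set lam := expect A fun a => (a : ℝ≥0∞) with hlam
  set S := expect A fun a => (a : ℝ≥0∞) ^ 2 with hS
  have h1 : ∀ w, M w ≠ 0 → expect (serve q A w x) (fun x => (x : ℝ≥0∞) ^ 2)
      + 2 * x * (ENNReal.ofReal (q : ℝ) * (min w x : ℕ))
      ≤ (x : ℝ≥0∞) ^ 2 + 2 * x * lam + S + N ^ 2 := by
    intro w hw
    rw [expect_serve, ← binomialPMF_mean, ← expect_const_mul, ← expect_add]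
    refine expect_le_const fun d hd => ?_
    have hd := le_of_binomialPMF_ne_zero hd
    have hwN := hN w hw
    calc _ = expect A fun a => ((x - d + a : ℕ) : ℝ≥0∞) ^ 2 + 2 * x * d := by
          rw [expect_add, expect_const]
      _ ≤ expect A fun a => (x : ℝ≥0∞) ^ 2 + 2 * x * a + a ^ 2 + N ^ 2 := by
          refine expect_mono fun a => ?_
          -- With `x = y + d` the right side exceeds the left by `2 * d * a + N ^ 2 - d ^ 2`, and `d
          -- ≤ N`.
          have : (x - d + a) ^ 2 + 2 * x * d ≤ x ^ 2 + 2 * x * a + a ^ 2 + N ^ 2 := by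
            obtain ⟨y, rfl⟩ := Nat.exists_eq_add_of_le (show d ≤ x by omega)
            rw [Nat.add_sub_cancel_left]
            have : d ≤ N := by omega
            nlinarith
          exact_mod_cast this
      _ = _ := by
          rw [expect_add, expect_add, expect_add, expect_const, expect_const, expect_const_mul]
  -- Replacing `min w x` by `w` matters only when `x < w ≤ N`, and then `x * w ≤ N ^ 2`; this adds
  -- `2 * N ^ 2` to the error.
  have h2 : ∀ w, M w ≠ 0 → expect (serve q A w x) (fun x => (x : ℝ≥0∞) ^ 2)
      + 2 * x * (ENNReal.ofReal (q : ℝ) * w)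
      ≤ (x : ℝ≥0∞) ^ 2 + 2 * x * lam + S + 3 * N ^ 2 := by
    intro w hw
    have hwN := hN w hw
    have h3 : (x : ℝ≥0∞) * w ≤ x * (min w x : ℕ) + N ^ 2 := by
      have : x * w ≤ x * min w x + N ^ 2 := by
        rcases le_total w x with h | h
        · rw [min_eq_left h]; omega
        · have := Nat.mul_le_mul (h.trans hwN) hwN
          rw [← sq] at this
          exact this.trans le_add_self
      exact_mod_cast this
    have hq1 : ENNReal.ofReal (q : ℝ) ≤ 1 := ENNReal.ofReal_le_one.2 q.2.2
    calc _ = expect (serve q A w x) (fun x => (x : ℝ≥0∞) ^ 2)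
          + 2 * (ENNReal.ofReal (q : ℝ) * (x * w)) := by ring
      _ ≤ expect (serve q A w x) (fun x => (x : ℝ≥0∞) ^ 2)
          + 2 * (ENNReal.ofReal (q : ℝ) * (x * (min w x : ℕ)) + 1 * N ^ 2) := by
          gcongr
          refine (mul_le_mul_right h3 _).trans ?_
          rw [mul_add]
          gcongr
      _ = expect (serve q A w x) (fun x => (x : ℝ≥0∞) ^ 2)
          + 2 * x * (ENNReal.ofReal (q : ℝ) * (min w x : ℕ)) + 2 * N ^ 2 := by ring
      _ ≤ _ := by
          refine (add_le_add_left (h1 w hw) _).trans_eq ?_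
          ring
  have h4 : kernelOp (queueStep q A M) (fun x => (x : ℝ≥0∞) ^ 2) x + 2 * x * (lam + ε)
      ≤ (x : ℝ≥0∞) ^ 2 + 2 * x * lam + S + 3 * N ^ 2 := by
    rw [hε, kernelOp_queueStep, ← expect_const_mul, ← expect_const_mul, ← expect_add]
    exact expect_le_const h2
  have hfin : 2 * (x : ℝ≥0∞) * lam ≠ ∞ := by finiteness
  refine (ENNReal.add_le_add_iff_left hfin).1 ?_
  calc _ = kernelOp (queueStep q A M) (fun x => (x : ℝ≥0∞) ^ 2) x + 2 * x * (lam + ε) := by ring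
    _ ≤ _ := h4
    _ = _ := by ring

/-- The mean length of a queue with negative drift stays bounded. -/
theorem exists_iterate_queueStep_bound {N : ℕ} (hN : ∀ w, M w ≠ 0 → w ≤ N) {ε : ℝ≥0∞} (h0 : ε ≠ 0)
    (hmean : expect A (fun a => (a : ℝ≥0∞)) ≠ ∞)
    (hsq : expect A (fun a => (a : ℝ≥0∞) ^ 2) ≠ ∞)
    (hε : expect A (fun a => (a : ℝ≥0∞)) + ε
      = ENNReal.ofReal (q : ℝ) * expect M fun w => (w : ℝ≥0∞)) :
    ∃ B : ℝ≥0∞, B ≠ ∞ ∧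
      ∀ n x, (kernelOp (queueStep q A M))^[n] (fun x => (x : ℝ≥0∞)) x ≤ B + x := by
  set T := kernelOp (queueStep q A M) with hT
  set C := expect A (fun a => (a : ℝ≥0∞) ^ 2) + 3 * (N : ℝ≥0∞) ^ 2 with hC
  have hCtop : C ≠ ∞ := by finiteness
  have hdrift : ∀ x, T (fun x => (x : ℝ≥0∞) ^ 2) x + 2 * ε * x ≤ (x : ℝ≥0∞) ^ 2 + C :=
    kernelOp_queueStep_sq_le hN hmean hε
  have hεtop : ε ≠ ∞ := by
    intro h
    have : expect M (fun w => (w : ℝ≥0∞)) ≤ N := expect_le_const fun w hw => by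
      exact_mod_cast hN w hw
    have h2 : ENNReal.ofReal (q : ℝ) * expect M (fun w => (w : ℝ≥0∞)) ≠ ∞ :=
      ENNReal.mul_ne_top (by simp) (ne_top_of_le_ne_top (by simp) this)
    rw [← hε, h] at h2
    simp at h2
  -- The drift inequality telescoped over `n` slots bounds the time average of the mean length.
  have hsum : ∀ n x, T^[n] (fun x => (x : ℝ≥0∞) ^ 2) x
      + ∑ k ∈ Finset.range n, 2 * ε * T^[k] (fun x => (x : ℝ≥0∞)) x ≤ (x : ℝ≥0∞) ^ 2 + n * C := by
    intro n
    induction n with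
    | zero => intro x; simp
    | succ n ih =>
      intro x
      rw [Finset.sum_range_succ']
      simp only [Function.iterate_succ_apply', Function.iterate_zero, id]
      have e1 : T (T^[n] fun x => (x : ℝ≥0∞) ^ 2) x
          + ∑ k ∈ Finset.range n, 2 * ε * T (T^[k] fun x => (x : ℝ≥0∞)) x
          = T (fun y => T^[n] (fun x => (x : ℝ≥0∞) ^ 2) y
            + ∑ k ∈ Finset.range n, 2 * ε * T^[k] (fun x => (x : ℝ≥0∞)) y) x := by
        simp only [hT, kernelOp]
        rw [expect_add, expect_finset_sum]
        simp only [expect_const_mul]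
      rw [← add_assoc, e1]
      have e2 : T (fun y => (y : ℝ≥0∞) ^ 2 + n * C) x
          = T (fun y => (y : ℝ≥0∞) ^ 2) x + n * C := by
        simp only [hT, kernelOp]
        rw [expect_add, expect_const]
      calc _ ≤ T (fun y => (y : ℝ≥0∞) ^ 2 + n * C) x + 2 * ε * x := by
            gcongr
            exact kernelOp_mono _ ih x
        _ = (T (fun y => (y : ℝ≥0∞) ^ 2) x + 2 * ε * x) + n * C := by
            rw [e2]; ring
        _ ≤ (x : ℝ≥0∞) ^ 2 + C + n * C := add_le_add_left (hdrift x) _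
        _ = _ := by push_cast; ring
  -- From the empty state the means are nondecreasing in time, so the mean at time `m` is at most
  -- its average over `[m, 2 * m)`. This turns the averaged bound into a bound for every slot.
  have hzero : ∀ n, T^[n] (fun x => (x : ℝ≥0∞)) 0 ≤ C / ε := by
    intro m
    rcases Nat.eq_zero_or_pos m with rfl | hm
    · simp
    have h1 := hsum (2 * m) 0
    have h2 : m * (2 * ε * T^[m] (fun x => (x : ℝ≥0∞)) 0)
        ≤ ∑ k ∈ Finset.range (2 * m), 2 * ε * T^[k] (fun x => (x : ℝ≥0∞)) 0 := by
      calc m * (2 * ε * T^[m] (fun x => (x : ℝ≥0∞)) 0)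
          = ∑ k ∈ Finset.Ico m (2 * m), 2 * ε * T^[m] (fun x => (x : ℝ≥0∞)) 0 := by
            rw [Finset.sum_const, Nat.card_Ico, nsmul_eq_mul]
            congr 2
            omega
        _ ≤ ∑ k ∈ Finset.Ico m (2 * m), 2 * ε * T^[k] (fun x => (x : ℝ≥0∞)) 0 := by
            refine Finset.sum_le_sum fun k hk => ?_
            gcongr
            exact iterate_queueStep_cast_zero_mono q A M (Finset.mem_Ico.1 hk).1
        _ ≤ _ := Finset.sum_le_sum_of_subset fun k hk => by
            simp only [Finset.mem_Ico, Finset.mem_range] at hk ⊢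
            omega
    have h3 : (2 * m : ℝ≥0∞) * (ε * T^[m] (fun x => (x : ℝ≥0∞)) 0) ≤ (2 * m : ℝ≥0∞) * C := by
      calc _ = m * (2 * ε * T^[m] (fun x => (x : ℝ≥0∞)) 0) := by ring
        _ ≤ _ := h2
        _ ≤ _ := le_add_self.trans h1
        _ = _ := by push_cast; ring
    have hm0 : (2 * m : ℝ≥0∞) ≠ 0 := by
      simp [hm.ne']
    have h4 := (ENNReal.mul_le_mul_iff_right hm0 (by finiteness)).1 h3
    rw [ENNReal.le_div_iff_mul_le (Or.inl h0) (Or.inl hεtop), mul_comm]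
    exact h4
  refine ⟨C / ε, ENNReal.div_ne_top hCtop h0, fun n x => ?_⟩
  exact (iterate_queueStep_cast_le q A M n x).trans (add_le_add_left (hzero n) _)

end Queue

/-! ### Coalescence of two queues -/

section Coalescence

variable (q : unitInterval) (A M : PMF ℕ)

/-- The averaging operator of a queue that is killed as soon as one additional request would have
been served. Its iterates bound the probability that two queues whose lengths differ by one, and
which are driven by the same randomness, still differ. -/
def killedOp (g : ℕ → ℝ≥0∞) (x : ℕ) : ℝ≥0∞ :=
  expect M fun w => (1 - extraService q w x) * expect (serve q A w x) g

/-- The probability of being killed in one slot. -/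
def killProb (x : ℕ) : ℝ≥0∞ := expect M fun w => extraService q w x

theorem killedOp_mono : Monotone (killedOp q A M) := fun _ _ h _ =>
  expect_mono fun _ => mul_le_mul_right (expect_mono h) _

theorem killedOp_le (g : ℕ → ℝ≥0∞) : killedOp q A M g ≤ kernelOp (queueStep q A M) g := by
  intro x
  rw [kernelOp_queueStep]
  exact expect_mono fun w => mul_le_of_le_one_left' tsub_le_self

theorem killedOp_iterate_le (g : ℕ → ℝ≥0∞) (n : ℕ) :
    (killedOp q A M)^[n] g ≤ (kernelOp (queueStep q A M))^[n] g := by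
  induction n with
  | zero => exact le_rfl
  | succ n ih =>
    simp only [Function.iterate_succ_apply']
    exact (killedOp_mono q A M ih).trans (killedOp_le q A M _)

theorem killedOp_add (f g : ℕ → ℝ≥0∞) :
    killedOp q A M (f + g) = killedOp q A M f + killedOp q A M g := by
  funext x
  simp only [killedOp, Pi.add_apply]
  rw [← expect_add]
  exact expect_congr fun w _ => by
    rw [← mul_add, ← expect_add]
    rfl

theorem killedOp_smul (c : ℝ≥0∞) (g : ℕ → ℝ≥0∞) :
    killedOp q A M (fun x => c * g x) = fun x => c * killedOp q A M g x := by
  funext x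
  simp only [killedOp]
  rw [← expect_const_mul]
  exact expect_congr fun w _ => by rw [expect_const_mul, mul_left_comm]

theorem killedOp_iterate_add (n : ℕ) (f g : ℕ → ℝ≥0∞) :
    (killedOp q A M)^[n] (f + g) = (killedOp q A M)^[n] f + (killedOp q A M)^[n] g := by
  induction n with
  | zero => rfl
  | succ n ih => simp only [Function.iterate_succ_apply', ih, killedOp_add]

theorem killedOp_iterate_smul (n : ℕ) (c : ℝ≥0∞) (g : ℕ → ℝ≥0∞) :
    (killedOp q A M)^[n] (fun x => c * g x) = fun x => c * (killedOp q A M)^[n] g x := by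
  induction n with
  | zero => rfl
  | succ n ih => simp only [Function.iterate_succ_apply', ih, killedOp_smul]

theorem killedOp_one_add_killProb : killedOp q A M 1 + killProb q M = 1 := by
  funext x
  simp only [killedOp, killProb, Pi.add_apply, Pi.one_apply]
  rw [← expect_add]
  calc _ = expect M fun _ => 1 := expect_congr fun w _ => by
        rw [show (1 : ℕ → ℝ≥0∞) = fun _ => 1 from rfl, expect_const, mul_one,
          one_sub_add_extraService]
    _ = 1 := expect_const M 1

theorem killedOp_iterate_one_le_one (n x : ℕ) : (killedOp q A M)^[n] 1 x ≤ 1 :=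
  (killedOp_iterate_le q A M 1 n x).trans
    (kernelOp_iterate_le_one _ (fun _ => le_rfl) n x)

/-- Surviving `n` slots means either surviving one more or being killed in the next. -/
theorem killedOp_iterate_one_succ (n x : ℕ) :
    (killedOp q A M)^[n + 1] 1 x + (killedOp q A M)^[n] (killProb q M) x
      = (killedOp q A M)^[n] 1 x := by
  conv_rhs => rw [← killedOp_one_add_killProb q A M, killedOp_iterate_add]
  rfl

theorem tendsto_killedOp_iterate_one_iInf (x : ℕ) :
    Tendsto (fun n => (killedOp q A M)^[n] 1 x) atTop (𝓝 (⨅ n, (killedOp q A M)^[n] 1 x)) :=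
  tendsto_atTop_iInf <| antitone_nat_of_succ_le fun n =>
    le_self_add.trans_eq (killedOp_iterate_one_succ q A M n x)

/-- These are the successive decrements of a convergent sequence of survival probabilities. -/
theorem tendsto_killedOp_iterate_killProb (x : ℕ) :
    Tendsto (fun n => (killedOp q A M)^[n] (killProb q M) x) atTop (𝓝 0) := by
  have h := tendsto_killedOp_iterate_one_iInf q A M x
  have hfin : (⨅ n, (killedOp q A M)^[n] 1 x) ≠ ∞ :=
    ne_top_of_le_ne_top ENNReal.one_ne_top
      ((iInf_le _ 0).trans (killedOp_iterate_one_le_one q A M 0 x))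
  have h2 := ENNReal.Tendsto.sub h (h.comp (tendsto_add_atTop_nat 1)) (Or.inl hfin)
  rw [tsub_self] at h2
  refine h2.congr fun n => ?_
  rw [← killedOp_iterate_one_succ q A M n x]
  exact ENNReal.add_sub_cancel_left
    (ne_top_of_le_ne_top ENNReal.one_ne_top (killedOp_iterate_one_le_one q A M (n + 1) x))

variable {q A M}

/-- From a level `x ≤ L` there is a uniformly positive chance either to be killed, if `x < w`, or
otherwise to fall below `L`, by serving `w` requests while only `a < w` arrive. -/
theorem indicator_le_killProb_add {w a : ℕ} (haw : a < w) (L x : ℕ) :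
    M w * ENNReal.ofReal (q : ℝ) ^ w * A a * (if x < L + 1 then 1 else 0)
      ≤ killProb q M x + killedOp q A M (fun y => if y < L then 1 else 0) x := by
  have hq1 : ENNReal.ofReal (q : ℝ) ≤ 1 := ENNReal.ofReal_le_one.2 q.2.2
  by_cases hx : x < L + 1
  swap
  · simp [hx]
  rw [if_pos hx, mul_one]
  by_cases hxw : x < w
  · refine le_add_right ?_
    calc M w * ENNReal.ofReal (q : ℝ) ^ w * A a ≤ M w * ENNReal.ofReal (q : ℝ) ^ 1 * 1 := by
          gcongr M w * ?_ * ?_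
          -- A single success kills, and `w ≥ 1` because `a < w`.
          · exact pow_le_pow_right_of_le_one' hq1 (by omega)
          · exact A.coe_le_one a
      _ = M w * extraService q w x := by simp [extraService, hxw]
      _ ≤ killProb q M x := mul_le_expect M _ w
  · refine le_add_left ?_
    have h1 : A a * 1 ≤ expect A fun a => if x - w + a < L then 1 else 0 := by
      refine le_trans ?_ (mul_le_expect A _ a)
      rw [if_pos (by omega)]
    calc M w * ENNReal.ofReal (q : ℝ) ^ w * A a
        = M w * (binomialPMF (min w x) q w * (A a * 1)) := by
          rw [min_eq_left (by omega), binomialPMF_apply_self]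
          ring
      _ ≤ M w * expect (serve q A w x) (fun y => if y < L then 1 else 0) := by
          gcongr
          rw [expect_serve]
          exact (mul_le_mul_right h1 _).trans (mul_le_expect (binomialPMF (min w x) q)
            (fun d => expect A fun a => if x - d + a < L then 1 else 0) w)
      _ = M w * ((1 - extraService q w x)
            * expect (serve q A w x) fun y => if y < L then 1 else 0) := by
          simp [extraService, hxw]
      _ ≤ _ := mul_le_expect M (fun w => (1 - extraService q w x)
            * expect (serve q A w x) fun y => if y < L then 1 else 0) w

/-- Induction on the level: being alive below `L + 1` forces, with a fixed positive chance, a kill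
or a visit below `L` in the next slot, and both have vanishing probability. -/
theorem tendsto_killedOp_iterate_indicator {w a : ℕ} (haw : a < w) (hw : M w ≠ 0) (ha : A a ≠ 0)
    (hq : 0 < (q : ℝ)) (L x : ℕ) :
    Tendsto (fun n => (killedOp q A M)^[n] (fun y => if y < L then 1 else 0) x) atTop (𝓝 0) := by
  induction L generalizing x with
  | zero =>
    have h0 : (fun y : ℕ => if y < 0 then (1 : ℝ≥0∞) else 0) = fun y => 0 * (1 : ℕ → ℝ≥0∞) y := by
      funext y; simp
    rw [h0]
    refine tendsto_const_nhds.congr fun n => ?_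
    rw [killedOp_iterate_smul]
    exact (zero_mul _).symm
  | succ L ih =>
    set δ := M w * ENNReal.ofReal (q : ℝ) ^ w * A a with hδ
    have hδ0 : δ ≠ 0 := mul_ne_zero (mul_ne_zero hw (pow_ne_zero _ (by simpa using hq))) ha
    have hδtop : δ ≠ ∞ := ENNReal.mul_ne_top (ENNReal.mul_ne_top (M.apply_ne_top w) (by finiteness))
      (A.apply_ne_top a)
    have hle : ∀ n, δ * (killedOp q A M)^[n] (fun y => if y < L + 1 then 1 else 0) x
        ≤ (killedOp q A M)^[n] (killProb q M) x
          + (killedOp q A M)^[n + 1] (fun y => if y < L then 1 else 0) x := by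
      intro n
      have h1 := ((killedOp_mono q A M).iterate n)
        (show (fun y => δ * (if y < L + 1 then 1 else 0)) ≤ killProb q M
          + killedOp q A M (fun y => if y < L then 1 else 0) from
          fun y => indicator_le_killProb_add haw L y) x
      rw [killedOp_iterate_smul, killedOp_iterate_add] at h1
      exact h1
    have hlim : Tendsto (fun n => (killedOp q A M)^[n] (killProb q M) x
        + (killedOp q A M)^[n + 1] (fun y => if y < L then 1 else 0) x) atTop (𝓝 0) := by
      simpa using (tendsto_killedOp_iterate_killProb q A M x).add
        ((ih x).comp (tendsto_add_atTop_nat 1))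
    have h2 : Tendsto (fun n => δ * (killedOp q A M)^[n] (fun y => if y < L + 1 then 1 else 0) x)
        atTop (𝓝 0) :=
      tendsto_of_tendsto_of_tendsto_of_le_of_le tendsto_const_nhds hlim (fun _ => zero_le) hle
    have h3 := ENNReal.Tendsto.const_mul (a := δ⁻¹) h2 (Or.inr (ENNReal.inv_ne_top.2 hδ0))
    simpa only [mul_zero, ← mul_assoc, ENNReal.inv_mul_cancel hδ0 hδtop, one_mul] using h3

/-- A surviving queue cannot stay at low levels, and Markov's inequality with the bounded mean keeps
it from escaping to high ones. -/
theorem tendsto_killedOp_iterate_one {w a : ℕ} (haw : a < w) (hw : M w ≠ 0) (ha : A a ≠ 0)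
    (hq : 0 < (q : ℝ)) {B : ℝ≥0∞} (hB : B ≠ ∞)
    (hbound : ∀ n x, (kernelOp (queueStep q A M))^[n] (fun x => (x : ℝ≥0∞)) x ≤ B + x) (x : ℕ) :
    Tendsto (fun n => (killedOp q A M)^[n] 1 x) atTop (𝓝 0) := by
  have h := tendsto_killedOp_iterate_one_iInf q A M x
  set l := ⨅ n, (killedOp q A M)^[n] 1 x with hl
  -- Splitting survival at level `L`: the part below `L` vanishes in the limit, and `L` times the
  -- part above is at most the mean `B + x`. As `L` is arbitrary, the limit `l` must be zero.
  have hlL : ∀ L : ℕ, L * l ≤ B + x := by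
    intro L
    have h1 : ∀ n, (L : ℝ≥0∞) * (killedOp q A M)^[n] 1 x
        ≤ L * (killedOp q A M)^[n] (fun y => if y < L then 1 else 0) x + (B + x) := by
      intro n
      have h2 := ((killedOp_mono q A M).iterate n)
        (show (fun y => (L : ℝ≥0∞) * (1 : ℕ → ℝ≥0∞) y)
          ≤ (fun y => (L : ℝ≥0∞) * (if y < L then 1 else 0)) + (fun y : ℕ => (y : ℝ≥0∞)) from by
          intro y
          by_cases hy : y < L
          · simp [hy]
          · simpa [hy] using not_lt.1 hy) x
      rw [killedOp_iterate_smul, killedOp_iterate_add, killedOp_iterate_smul] at h2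
      refine h2.trans (add_le_add_right ?_ _)
      exact (killedOp_iterate_le q A M _ n x).trans (hbound n x)
    have h3 := ENNReal.Tendsto.const_mul (a := (L : ℝ≥0∞)) h (Or.inr (by simp))
    have h4 := (ENNReal.Tendsto.const_mul (a := (L : ℝ≥0∞))
      (tendsto_killedOp_iterate_indicator haw hw ha hq L x) (Or.inr (by simp))).add_const (B + x)
    simpa using le_of_tendsto_of_tendsto' h3 h4 h1
  have hl0 : l = 0 := by
    by_contra hne
    obtain ⟨L, hL⟩ := ENNReal.exists_nat_mul_gt hne (show B + x ≠ ∞ by finiteness)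
    exact absurd (hlL L) (not_le.2 hL)
  rwa [hl0] at h

/-- If the service rate exceeds the arrival rate, then some possible number of services exceeds
some possible number of arrivals. -/
theorem exists_arrivals_lt_services
    (hlt : expect A (fun a => (a : ℝ≥0∞)) < ENNReal.ofReal (q : ℝ) * expect M fun w => (w : ℝ≥0∞)) :
    ∃ a w, a < w ∧ M w ≠ 0 ∧ A a ≠ 0 := by
  by_contra! hcon
  have h1 : expect M (fun w => (w : ℝ≥0∞)) ≤ expect A fun a => (a : ℝ≥0∞) :=
    expect_le_const fun w hw => const_le_expect fun a ha => by
      by_contra hlt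
      exact ha (hcon a w (by simpa using hlt) hw)
  have hq1 : ENNReal.ofReal (q : ℝ) ≤ 1 := ENNReal.ofReal_le_one.2 q.2.2
  exact absurd hlt (not_lt.2 ((mul_le_of_le_one_left' hq1).trans h1))

end Coalescence

/-! ### Queues with state-independent scheduling -/

section Network

variable {ι : Type*} [Fintype ι] (q : ι → unitInterval) (A : ι → PMF ℕ) (M : PMF (ι → ℕ))

/-- The transition law of a family of queues in which the vectors of the numbers of attempted
services have the law `M`. -/
def networkStep (x : ι → ℕ) : PMF (ι → ℕ) :=
  M.bind fun W => piPMF fun e => serve (q e) (A e) (W e) (x e)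

/-- The marginal transition law of the queue `e`. -/
abbrev marginalStep (e : ι) : ℕ → PMF ℕ := queueStep (q e) (A e) (M.map fun W => W e)

theorem kernelOp_networkStep (g : (ι → ℕ) → ℝ≥0∞) (x : ι → ℕ) :
    kernelOp (networkStep q A M) g x
      = expect M fun W => expect (piPMF fun e => serve (q e) (A e) (W e) (x e)) g := by
  rw [kernelOp, networkStep, expect_bind]

/-- The queues share the vector of services and are dependent, but since its law ignores the state
each coordinate is a Markov chain by itself. -/
theorem kernelOp_networkStep_eval (e : ι) (g : ℕ → ℝ≥0∞) :
    kernelOp (networkStep q A M) (fun x => g (x e))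
      = fun x => kernelOp (marginalStep q A M e) g (x e) := by
  funext x
  rw [kernelOp_networkStep, kernelOp_queueStep, expect_map]
  exact expect_congr fun W _ => expect_piPMF_eval _ e g

theorem iterate_networkStep_eval (e : ι) (g : ℕ → ℝ≥0∞) (n : ℕ) :
    (kernelOp (networkStep q A M))^[n] (fun x => g (x e))
      = fun x => (kernelOp (marginalStep q A M e))^[n] g (x e) := by
  induction n with
  | zero => rfl
  | succ n ih => simp only [Function.iterate_succ_apply', ih, kernelOp_networkStep_eval]

section Bump

variable [DecidableEq ι]

/-- One additional request for `e`. -/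
abbrev bump (e : ι) (x : ι → ℕ) : ι → ℕ := Function.update x e (x e + 1)

theorem expect_piPMF_serve_bump (e : ι) (W x : ι → ℕ) (g : (ι → ℕ) → ℝ≥0∞) :
    expect (piPMF fun i => serve (q i) (A i) (W i) (bump e x i)) g
      = expect (piPMF fun i => serve (q i) (A i) (W i) (x i)) fun y =>
        (1 - extraService (q e) (W e) (x e)) * g (bump e y)
          + extraService (q e) (W e) (x e) * g y := by
  have h1 : (piPMF fun i => serve (q i) (A i) (W i) (bump e x i))
      = (piPMF fun i => serve (q i) (A i) (W i) (x i)).bind fun y => piPMF fun i =>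
        if i = e then (binomialPMF (if x e < W e then 1 else 0) (q e)).map (fun s => y e + 1 - s)
          else PMF.pure (y i) := by
    have h2 := piPMF_bind (fun i => serve (q i) (A i) (W i) (x i)) fun i n =>
        if i = e then (binomialPMF (if x e < W e then 1 else 0) (q e)).map (fun s => n + 1 - s)
          else PMF.pure n
    convert h2.symm using 3 with i y i
    · by_cases hi : i = e
      · subst hi
        simp only [bump, Function.update_self, if_true, serve_succ]
      · simp only [bump, Function.update_of_ne hi, if_neg hi, PMF.bind_pure]
    · congr 1
      funext i
      by_cases hi : i = e
      · subst hi; simp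
      · simp [hi]
  rw [h1, expect_bind]
  refine expect_congr fun y _ => ?_
  rw [piPMF_update, expect_map, expect_map, expect_binomialPMF_extra, Nat.sub_zero,
    Nat.add_sub_cancel, Function.update_eq_self]

/-- If the extra request is served the two networks coincide; only the unserved part carries the
discrepancy `κ` forward, which is one application of `killedOp`. -/
theorem kernelOp_networkStep_bump_le {g : (ι → ℕ) → ℝ≥0∞} {κ : ℕ → ℝ≥0∞} {e : ι}
    (h : ∀ y, g (bump e y) ≤ g y + κ (y e)) (x : ι → ℕ) :
    kernelOp (networkStep q A M) g (bump e x)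
      ≤ kernelOp (networkStep q A M) g x
        + killedOp (q e) (A e) (M.map fun W => W e) κ (x e) := by
  rw [kernelOp_networkStep, kernelOp_networkStep, killedOp, expect_map, ← expect_add]
  refine expect_mono fun W => ?_
  rw [expect_piPMF_serve_bump, ← expect_piPMF_eval (fun i => serve (q i) (A i) (W i) (x i)) e κ,
    ← expect_const_mul, ← expect_add]
  refine expect_mono fun y => ?_
  calc _ ≤ (1 - extraService (q e) (W e) (x e)) * (g y + κ (y e))
        + extraService (q e) (W e) (x e) * g y := by gcongr; exact h y
    _ = (1 - extraService (q e) (W e) (x e) + extraService (q e) (W e) (x e)) * g y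
        + (1 - extraService (q e) (W e) (x e)) * κ (y e) := by ring
    _ = _ := by rw [one_sub_add_extraService, one_mul]

theorem kernelOp_networkStep_le_bump {g : (ι → ℕ) → ℝ≥0∞} {κ : ℕ → ℝ≥0∞} {e : ι}
    (h : ∀ y, g y ≤ g (bump e y) + κ (y e)) (x : ι → ℕ) :
    kernelOp (networkStep q A M) g x
      ≤ kernelOp (networkStep q A M) g (bump e x)
        + killedOp (q e) (A e) (M.map fun W => W e) κ (x e) := by
  rw [kernelOp_networkStep, kernelOp_networkStep, killedOp, expect_map, ← expect_add]
  refine expect_mono fun W => ?_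
  rw [expect_piPMF_serve_bump, ← expect_piPMF_eval (fun i => serve (q i) (A i) (W i) (x i)) e κ,
    ← expect_const_mul, ← expect_add]
  refine expect_mono fun y => ?_
  calc g y = (1 - extraService (q e) (W e) (x e)) * g y
        + extraService (q e) (W e) (x e) * g y := by
          rw [← add_mul, one_sub_add_extraService, one_mul]
    _ ≤ (1 - extraService (q e) (W e) (x e)) * (g (bump e y) + κ (y e))
        + extraService (q e) (W e) (x e) * g y := by gcongr; exact h y
    _ = _ := by ring

theorem iterate_networkStep_bump {f : (ι → ℕ) → ℝ≥0∞} (hf : ∀ x, f x ≤ 1) (n : ℕ) (e : ι)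
    (x : ι → ℕ) :
    (kernelOp (networkStep q A M))^[n] f (bump e x)
        ≤ (kernelOp (networkStep q A M))^[n] f x
          + (killedOp (q e) (A e) (M.map fun W => W e))^[n] 1 (x e) ∧
      (kernelOp (networkStep q A M))^[n] f x
        ≤ (kernelOp (networkStep q A M))^[n] f (bump e x)
          + (killedOp (q e) (A e) (M.map fun W => W e))^[n] 1 (x e) := by
  induction n generalizing x with
  | zero => exact ⟨le_add_left (hf _), le_add_left (hf _)⟩
  | succ n ih =>
    simp only [Function.iterate_succ_apply']
    exact ⟨kernelOp_networkStep_bump_le q A M (fun y => (ih y).1) x,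
      kernelOp_networkStep_le_bump q A M (fun y => (ih y).2) x⟩

end Bump

/-- The memory of the initial state is lost. -/
theorem exists_coupling_bound
    (hκ : ∀ e x, Tendsto (fun n => (killedOp (q e) (A e) (M.map fun W => W e))^[n] 1 x)
      atTop (𝓝 0)) (z : ι → ℕ) :
    ∃ c : ℕ → ℝ≥0∞, Tendsto c atTop (𝓝 0) ∧ ∀ (n : ℕ) (f : (ι → ℕ) → ℝ≥0∞), (∀ x, f x ≤ 1) →
      (kernelOp (networkStep q A M))^[n] f z ≤ (kernelOp (networkStep q A M))^[n] f 0 + c n ∧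
      (kernelOp (networkStep q A M))^[n] f 0 ≤ (kernelOp (networkStep q A M))^[n] f z + c n := by
  classical
  -- The state `z` is reduced to the empty network one request at a time, each removal costing one
  -- survival probability.
  induction hs : ∑ e, z e generalizing z with
  | zero =>
    have hz : z = 0 := by
      funext e
      exact Finset.sum_eq_zero_iff.1 hs e (Finset.mem_univ e)
    subst hz
    exact ⟨fun _ => 0, tendsto_const_nhds, fun n f _ => by simp⟩
  | succ s ih =>
    obtain ⟨e, -, he⟩ : ∃ e ∈ Finset.univ, z e ≠ 0 := by
      by_contra! h
      rw [Finset.sum_eq_zero h] at hs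
      omega
    set y := Function.update z e (z e - 1) with hy
    have hzy : z = bump e y := by
      funext i
      by_cases hi : i = e
      · subst hi; simp [hy]; omega
      · simp [hy, hi]
    have hsum : ∑ i, y i = s := by
      rw [hy, Finset.sum_update_of_mem (Finset.mem_univ e)]
      rw [← Finset.add_sum_erase _ _ (Finset.mem_univ e)] at hs
      rw [← Finset.erase_eq]
      omega
    obtain ⟨c, hc, hcb⟩ := ih y hsum
    refine ⟨fun n => c n + (killedOp (q e) (A e) (M.map fun W => W e))^[n] 1 (y e),
      by simpa using hc.add (hκ e (y e)), fun n f hf => ?_⟩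
    obtain ⟨h1, h2⟩ := iterate_networkStep_bump q A M hf n e y
    obtain ⟨h3, h4⟩ := hcb n f hf
    rw [← hzy] at h1 h2
    constructor
    · refine h1.trans ?_
      rw [← add_assoc]
      gcongr
    · refine h4.trans ?_
      dsimp only
      rw [add_comm (c n), ← add_assoc]
      gcongr

end Network

/-! ### Convergence of Markov chains that forget their initial state -/

section Convergence

variable {ι : Type*} [Fintype ι] {k : (ι → ℕ) → PMF (ι → ℕ)} {B : ι → ℝ≥0∞}

-- Tightness by Markov's inequality for the total queue length, uniformly in time.
open Classical in
theorem exists_iterate_tail_le (hB : ∀ e, B e ≠ ∞)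
    (hmean : ∀ n e, (kernelOp k)^[n] (fun x => (x e : ℝ≥0∞)) 0 ≤ B e) {δ : ℝ≥0∞} (hδ : δ ≠ 0) :
    ∃ L : ℕ, ∀ n, (kernelOp k)^[n]
      (fun z => if z ∈ Fintype.piFinset (fun _ : ι => Finset.range L) then 0 else 1) 0 ≤ δ := by
  have hsum : ∑ e, B e ≠ ∞ := ENNReal.sum_ne_top.2 fun e _ => hB e
  obtain ⟨L, hL⟩ := ENNReal.exists_nat_mul_gt hδ hsum
  have hL0 : (L : ℝ≥0∞) ≠ 0 := by
    rintro h
    simp [h] at hL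
  refine ⟨L, fun n => ?_⟩
  have h1 := kernelOp_iterate_mono k n (show (fun z : ι → ℕ => (L : ℝ≥0∞) *
      (if z ∈ Fintype.piFinset (fun _ : ι => Finset.range L) then 0 else 1))
      ≤ fun z => ∑ e, (z e : ℝ≥0∞) from ?_) 0
  · rw [kernelOp_iterate_const_mul, kernelOp_iterate_finset_sum] at h1
    have h2 := (h1.trans (Finset.sum_le_sum fun e _ => hmean n e)).trans hL.le
    exact (ENNReal.mul_le_mul_iff_right hL0 (by simp)).1 h2
  · intro z
    dsimp only
    split_ifs with hz
    · simp
    · simp only [Fintype.mem_piFinset, Finset.mem_range, not_forall, not_lt] at hz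
      obtain ⟨e, he⟩ := hz
      rw [mul_one]
      exact (Nat.cast_le.2 he).trans
        (Finset.single_le_sum (f := fun e => (z e : ℝ≥0∞)) (fun _ _ => zero_le)
          (Finset.mem_univ e))

theorem exists_limit_of_uniform_cauchy {a : ℕ → ℝ≥0∞}
    (h : ∀ δ : ℝ≥0∞, δ ≠ 0 → ∃ N, ∀ n ≥ N, ∀ m, a (n + m) ≤ a n + δ ∧ a n ≤ a (n + m) + δ) :
    ∃ l, Tendsto a atTop (𝓝 l) := by
  refine ⟨liminf a atTop, tendsto_of_le_liminf_of_limsup_le le_rfl ?_⟩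
  refine ENNReal.le_of_forall_pos_le_add fun δ hδ _ => ?_
  obtain ⟨N, hN⟩ := h (δ / 2) (by simpa using hδ.ne')
  have h1 : limsup a atTop ≤ a N + δ / 2 :=
    limsup_le_of_le (by isBoundedDefault) <| eventually_atTop.2 ⟨N, fun n hn => by
      obtain ⟨m, rfl⟩ := Nat.exists_eq_add_of_le hn
      exact (hN N le_rfl m).1⟩
  have h2 : a N - δ / 2 ≤ liminf a atTop :=
    le_liminf_of_le (by isBoundedDefault) <| eventually_atTop.2 ⟨N, fun n hn => by
      obtain ⟨m, rfl⟩ := Nat.exists_eq_add_of_le hn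
      exact tsub_le_iff_right.2 (hN N le_rfl m).2⟩
  calc limsup a atTop ≤ a N + δ / 2 := h1
    _ ≤ liminf a atTop + δ / 2 + δ / 2 := by gcongr; exact tsub_le_iff_right.1 h2
    _ = _ := by rw [add_assoc, ENNReal.add_halves]

variable (hc : ∀ z, ∃ c : ℕ → ℝ≥0∞, Tendsto c atTop (𝓝 0) ∧
  ∀ (n : ℕ) (f : (ι → ℕ) → ℝ≥0∞), (∀ x, f x ≤ 1) →
    (kernelOp k)^[n] f z ≤ (kernelOp k)^[n] f 0 + c n ∧
    (kernelOp k)^[n] f 0 ≤ (kernelOp k)^[n] f z + c n)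
  (hB : ∀ e, B e ≠ ∞)
  (hmean : ∀ n e, (kernelOp k)^[n] (fun x => (x e : ℝ≥0∞)) 0 ≤ B e)

include hc hB hmean

/-- Cauchy property: the state after `m` slots lies in a finite box up to small probability, and
from all states of that box the next `n` slots give nearly the same expectation as from `0`. -/
theorem exists_tendsto_iterate_zero {f : (ι → ℕ) → ℝ≥0∞} (hf : ∀ x, f x ≤ 1) :
    ∃ l, Tendsto (fun n => (kernelOp k)^[n] f 0) atTop (𝓝 l) := by
  classical
  refine exists_limit_of_uniform_cauchy fun δ hδ => ?_
  have hδ2 : δ / 2 ≠ 0 := by simpa using hδ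
  obtain ⟨L, hL⟩ := exists_iterate_tail_le hB hmean hδ2
  set F := Fintype.piFinset (fun _ : ι => Finset.range L) with hF
  choose c hc0 hcb using hc
  have hsum : Tendsto (fun n => ∑ z ∈ F, c z n) atTop (𝓝 0) := by
    simpa using tendsto_finsetSum F fun z _ => hc0 z
  obtain ⟨N, hN⟩ := eventually_atTop.1 (hsum.eventually (ge_mem_nhds (pos_iff_ne_zero.2 hδ2)))
  refine ⟨N, fun n hn m => ?_⟩
  have hcF : ∀ z ∈ F, c z n ≤ δ / 2 := fun z hz =>
    (Finset.single_le_sum (f := fun z => c z n) (fun _ _ => zero_le) hz).trans (hN n hn)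
  have hle1 : ∀ z, (kernelOp k)^[n] f z ≤ 1 := kernelOp_iterate_le_one k hf n
  have h1 := kernelOp_iterate_mono k m (show (kernelOp k)^[n] f ≤ fun z =>
      ((kernelOp k)^[n] f 0 + δ / 2) + (if z ∈ F then 0 else 1) from fun z => by
    by_cases hz : z ∈ F
    · simpa [hz] using ((hcb z n f hf).1).trans (add_le_add_right (hcF z hz) _)
    · simp only [hz, if_false]
      exact le_add_left (hle1 z)) 0
  have h2 := kernelOp_iterate_mono k m (show (fun _ => (kernelOp k)^[n] f 0) ≤ fun z =>
      ((kernelOp k)^[n] f z + δ / 2) + (if z ∈ F then 0 else 1) from fun z => by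
    by_cases hz : z ∈ F
    · simpa [hz] using ((hcb z n f hf).2).trans (add_le_add_right (hcF z hz) _)
    · simp only [hz, if_false]
      exact le_add_left (hle1 0)) 0
  rw [kernelOp_iterate_add, kernelOp_iterate_const, ← Function.iterate_add_apply] at h1
  rw [kernelOp_iterate_add, kernelOp_iterate_add, kernelOp_iterate_const, kernelOp_iterate_const,
    ← Function.iterate_add_apply] at h2
  rw [add_comm n m]
  constructor
  · refine (h1.trans (add_le_add_right (hL m) _)).trans_eq ?_
    rw [add_assoc, ENNReal.add_halves]
  · refine (h2.trans (add_le_add_right (hL m) _)).trans_eq ?_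
    rw [add_assoc, ENNReal.add_halves]

-- The limits of the point probabilities form a law because tightness prevents loss of mass; the
-- mean bound passes to the limit through finite partial sums.
open Classical in
theorem exists_limit_pmf :
    ∃ ν : PMF (ι → ℕ),
      (∀ x y, Tendsto (fun n => (kernelOp k)^[n] (fun z => if z = y then 1 else 0) x) atTop
        (𝓝 (ν y))) ∧
      ∀ e, expect ν (fun x => (x e : ℝ≥0∞)) ≤ B e := by
  have hind : ∀ y x : ι → ℕ, (if x = y then (1 : ℝ≥0∞) else 0) ≤ 1 := fun y x => by
    split_ifs <;> simp
  choose ν hν using fun y => exists_tendsto_iterate_zero hc hB hmean (hind y)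
  have hfin : ∀ (s : Finset (ι → ℕ)) (g : (ι → ℕ) → ℝ≥0∞), (∀ y, g y ≠ ∞) →
      Tendsto (fun n => (kernelOp k)^[n] (fun z => ∑ y ∈ s, g y * if z = y then 1 else 0) 0) atTop
        (𝓝 (∑ y ∈ s, g y * ν y)) := by
    intro s g hg
    refine (tendsto_finsetSum s fun y _ =>
      ENNReal.Tendsto.const_mul (hν y) (Or.inr (hg y))).congr fun n => ?_
    rw [kernelOp_iterate_finset_sum]
    simp only [kernelOp_iterate_const_mul]
  have hsum : ∑' y, ν y = 1 := by
    refine le_antisymm ?_ ?_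
    · rw [ENNReal.tsum_eq_iSup_sum]
      refine iSup_le fun s => ?_
      have h1 := hfin s (fun _ => 1) (by simp)
      simp only [one_mul] at h1
      refine le_of_tendsto' h1 fun n => kernelOp_iterate_le_one k (fun z => ?_) n 0
      rw [Finset.sum_ite_eq]
      split_ifs <;> simp
    · refine ENNReal.le_of_forall_pos_le_add fun δ hδ _ => ?_
      obtain ⟨L, hL⟩ := exists_iterate_tail_le hB hmean (δ := δ) (by simpa using hδ.ne')
      set F := Fintype.piFinset (fun _ : ι => Finset.range L) with hF
      have h1 := (hfin F (fun _ => 1) (by simp)).add_const (δ : ℝ≥0∞)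
      simp only [one_mul] at h1
      refine (ge_of_tendsto' h1 fun n => ?_).trans
        (add_le_add_left (ENNReal.sum_le_tsum F) _)
      have h2 : (fun z : ι → ℕ => (∑ y ∈ F, if z = y then (1 : ℝ≥0∞) else 0)
          + (if z ∈ F then 0 else 1)) = fun _ => 1 := by
        funext z
        rw [Finset.sum_ite_eq]
        split_ifs <;> simp
      have h3 := congrFun (kernelOp_iterate_const k 1 n) 0
      rw [← h2, kernelOp_iterate_add] at h3
      calc (1 : ℝ≥0∞) = _ := h3.symm
        _ ≤ _ := add_le_add_right (hL n) _
  refine ⟨⟨ν, hsum ▸ ENNReal.summable.hasSum⟩, fun x y => ?_, fun e => ?_⟩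
  · obtain ⟨c, hc0, hcb⟩ := hc x
    have h1 : Tendsto (fun n => (kernelOp k)^[n] (fun z => if z = y then 1 else 0) 0 + c n) atTop
        (𝓝 (ν y)) := by simpa using (hν y).add hc0
    have h2 : Tendsto (fun n => (kernelOp k)^[n] (fun z => if z = y then 1 else 0) 0 - c n) atTop
        (𝓝 (ν y)) := by simpa using ENNReal.Tendsto.sub (hν y) hc0 (Or.inr (by simp))
    exact tendsto_of_tendsto_of_tendsto_of_le_of_le h2 h1
      (fun n => tsub_le_iff_right.2 (hcb n _ (hind y)).2) (fun n => (hcb n _ (hind y)).1)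
  · change ∑' y, ν y * (y e : ℝ≥0∞) ≤ B e
    rw [ENNReal.tsum_eq_iSup_sum]
    refine iSup_le fun s => ?_
    have h1 := hfin s (fun y => (y e : ℝ≥0∞)) (by simp)
    simp only [mul_comm _ (ν _)] at h1
    refine le_of_tendsto' h1 fun n => le_trans (kernelOp_iterate_mono k n ?_ 0) (hmean n e)
    intro z
    dsimp only
    calc ∑ y ∈ s, (y e : ℝ≥0∞) * (if z = y then 1 else 0)
        = ∑ y ∈ s, if z = y then (z e : ℝ≥0∞) else 0 := by
          refine Finset.sum_congr rfl fun y _ => ?_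
          by_cases h : z = y
          · simp [h]
          · simp [h]
      _ ≤ z e := by
          rw [Finset.sum_ite_eq]
          split_ifs <;> simp

end Convergence

/-- On a discrete space, pointwise convergence of probability mass functions to a probability mass
function implies weak convergence. -/
theorem tendsto_probabilityMeasure_of_tendsto_pmf {α : Type*} [MeasurableSpace α]
    [TopologicalSpace α] [OpensMeasurableSpace α] [Countable α] [MeasurableSingletonClass α]
    {p : ℕ → PMF α} {ν : PMF α} (h : ∀ y, Tendsto (fun n => p n y) atTop (𝓝 (ν y))) :
    Tendsto (β := ProbabilityMeasure α) (fun n => ⟨(p n).toMeasure, inferInstance⟩) atTop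
      (𝓝 (⟨ν.toMeasure, inferInstance⟩ : ProbabilityMeasure α)) := by
  refine tendsto_of_forall_isOpen_le_liminf' fun G _ => ?_
  simp only [ProbabilityMeasure.coe_mk, PMF.toMeasure_apply_eq_tsum]
  -- Fatou's lemma for the counting measure gives the lower bound on open sets in the portmanteau
  -- theorem.
  have h1 := lintegral_liminf_le (μ := Measure.count) (u := atTop)
    (f := fun n y => G.indicator (p n) y) fun n => measurable_of_countable _
  simp only [lintegral_count] at h1
  refine le_trans (ENNReal.tsum_le_tsum fun y => ?_) h1
  by_cases hy : y ∈ G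
  · simp only [Set.indicator_of_mem hy]
    exact (h y).liminf_eq.ge
  · simp [hy]

/-- A family of queues with state-independent scheduling whose service rates exceed the arrival
rates has a limit law with finite means. -/
theorem exists_networkStep_limit {ι : Type*} [Fintype ι] {q : ι → unitInterval} {A : ι → PMF ℕ}
    {M : PMF (ι → ℕ)} (hq : ∀ e, 0 < (q e : ℝ)) {N : ℕ} (hN : ∀ W, M W ≠ 0 → ∀ e, W e ≤ N)
    (hsq : ∀ e, expect (A e) (fun a => (a : ℝ≥0∞) ^ 2) ≠ ∞)
    (hlt : ∀ e, expect (A e) (fun a => (a : ℝ≥0∞))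
      < ENNReal.ofReal (q e : ℝ) * expect M fun W => (W e : ℝ≥0∞)) :
    ∃ ν : PMF (ι → ℕ),
      (∀ x y, Tendsto (fun n => (kernelOp (networkStep q A M))^[n]
        (fun z => open Classical in if z = y then 1 else 0) x) atTop (𝓝 (ν y))) ∧
      ∀ e, expect ν (fun x => (x e : ℝ≥0∞)) ≠ ∞ := by
  have hlt' : ∀ e, expect (A e) (fun a => (a : ℝ≥0∞)) < ENNReal.ofReal (q e : ℝ)
      * expect (M.map fun W => W e) fun w : ℕ => (w : ℝ≥0∞) := fun e => by
    rw [expect_map]; exact hlt e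
  have hB : ∀ e, ∃ B : ℝ≥0∞, B ≠ ∞ ∧ ∀ n x,
      (kernelOp (marginalStep q A M e))^[n] (fun x => (x : ℝ≥0∞)) x ≤ B + x := fun e => by
    refine exists_iterate_queueStep_bound (N := N)
      (ε := _ - expect (A e) (fun a => (a : ℝ≥0∞))) ?_ (tsub_pos_of_lt (hlt' e)).ne'
      (hlt e).ne_top (hsq e) (add_tsub_cancel_of_le (hlt' e).le)
    intro w hw
    obtain ⟨W, hW, rfl⟩ := (PMF.mem_support_map_iff _ _ _).1 hw
    exact hN W hW e
  choose B hBtop hB using hB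
  have hκ : ∀ e x, Tendsto (fun n => (killedOp (q e) (A e) (M.map fun W => W e))^[n] 1 x)
      atTop (𝓝 0) := fun e x => by
    obtain ⟨a, w, haw, hw, ha⟩ := exists_arrivals_lt_services (hlt' e)
    exact tendsto_killedOp_iterate_one haw hw ha (hq e) (hBtop e) (hB e) x
  obtain ⟨ν, hν, hmean⟩ := exists_limit_pmf (exists_coupling_bound q A M hκ) hBtop fun n e => by
    rw [iterate_networkStep_eval q A M e fun x => (x : ℝ≥0∞)]
    simpa using hB e n 0
  exact ⟨ν, hν, fun e => ne_top_of_le_ne_top (hBtop e) (hmean e)⟩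

/-! ### Arrivals and purified entanglements -/

theorem expect_eq_ofReal {p : PMF ℕ} {g : ℕ → ℝ} (hg : ∀ k, 0 ≤ g k)
    (hs : Summable fun k => g k * (p k).toReal) :
    expect p (fun k => ENNReal.ofReal (g k)) = ENNReal.ofReal (∑' k, g k * (p k).toReal) := by
  rw [ENNReal.ofReal_tsum_of_nonneg (fun k => mul_nonneg (hg k) ENNReal.toReal_nonneg) hs]
  refine tsum_congr fun k => ?_
  rw [ENNReal.ofReal_mul (hg k), ENNReal.ofReal_toReal (p.apply_ne_top k), mul_comm]

namespace IsArrivalLaw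

variable {K : ℕ} {A : UserPair K → PMF ℕ} {lam : UserPair K → ℝ}

theorem expect_eq (h : IsArrivalLaw A lam) (e : UserPair K) :
    expect (A e) (fun k => (k : ℝ≥0∞)) = ENNReal.ofReal (lam e) := by
  have := expect_eq_ofReal (fun k => Nat.cast_nonneg k) (h.mean e).summable
  simpa only [ENNReal.ofReal_natCast, (h.mean e).tsum_eq] using this

theorem expect_sq_ne_top (h : IsArrivalLaw A lam) (e : UserPair K) :
    expect (A e) (fun k => (k : ℝ≥0∞) ^ 2) ≠ ∞ := by
  have := expect_eq_ofReal (fun k => sq_nonneg (k : ℝ)) (h.second_moment e)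
  simp only [ENNReal.ofReal_pow (Nat.cast_nonneg _), ENNReal.ofReal_natCast] at this
  rw [this]
  exact ENNReal.ofReal_ne_top

theorem nonneg (h : IsArrivalLaw A lam) : 0 ≤ lam := fun e =>
  (h.mean e).nonneg fun k => mul_nonneg (Nat.cast_nonneg k) ENNReal.toReal_nonneg

end IsArrivalLaw

namespace Switch

variable {K : ℕ} (S : Switch K)

theorem mem_linkStates {a : Fin K → ℕ} : a ∈ S.linkStates ↔ ∀ i, a i ≤ S.alphaMax := by
  simp [linkStates]

theorem linkProb_nonneg (i : Fin K) (x : ℕ) : 0 ≤ S.linkProb i x :=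
  mul_nonneg (mul_nonneg (Nat.cast_nonneg _) (pow_nonneg (S.p i).2.1 _))
    (pow_nonneg (sub_nonneg.2 (S.p i).2.2) _)

theorem purifiedLinkProb_nonneg (i : Fin K) (y : ℕ) : 0 ≤ S.purifiedLinkProb i y :=
  Finset.sum_nonneg fun x _ => mul_nonneg ENNReal.toReal_nonneg (S.linkProb_nonneg i x)

theorem purifiedProb_nonneg (a : Fin K → ℕ) : 0 ≤ S.purifiedProb a :=
  Finset.prod_nonneg fun i _ => S.purifiedLinkProb_nonneg i (a i)

theorem binomialPMF_alphaMax (i : Fin K) (x : ℕ) :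
    binomialPMF S.alphaMax (S.p i) x = ENNReal.ofReal (S.linkProb i x) :=
  binomialPMF_apply _ _ _

theorem bind_yield_apply (i : Fin K) (y : ℕ) :
    (binomialPMF S.alphaMax (S.p i)).bind S.yield y = ENNReal.ofReal (S.purifiedLinkProb i y) := by
  rw [PMF.bind_apply, tsum_eq_sum (s := Finset.Icc y S.alphaMax), purifiedLinkProb,
    ENNReal.ofReal_sum_of_nonneg fun x _ =>
      mul_nonneg ENNReal.toReal_nonneg (S.linkProb_nonneg i x)]
  · refine Finset.sum_congr rfl fun x _ => ?_
    rw [ENNReal.ofReal_mul ENNReal.toReal_nonneg, ENNReal.ofReal_toReal ((S.yield x).apply_ne_top y),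
      binomialPMF_alphaMax, mul_comm]
  · intro x hx
    by_contra h
    rw [mul_eq_zero, not_or] at h
    exact hx (Finset.mem_Icc.2 ⟨S.yield_le x y h.2, le_of_binomialPMF_ne_zero h.1⟩)

theorem purifiedLaw_apply (a : Fin K → ℕ) :
    S.purifiedLaw a = ENNReal.ofReal (S.purifiedProb a) := by
  rw [purifiedLaw, piPMF_apply, purifiedProb,
    ENNReal.ofReal_prod_of_nonneg fun i _ => S.purifiedLinkProb_nonneg i (a i)]
  simp only [bind_yield_apply]

theorem purifiedLaw_ne_zero {a : Fin K → ℕ} : S.purifiedLaw a ≠ 0 ↔ 0 < S.purifiedProb a := by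
  rw [purifiedLaw_apply]
  simp

theorem mem_linkStates_of_pos {a : Fin K → ℕ} (h : 0 < S.purifiedProb a) : a ∈ S.linkStates := by
  rw [mem_linkStates]
  intro i
  by_contra hi
  refine h.ne' (Finset.prod_eq_zero (Finset.mem_univ i) ?_)
  rw [purifiedLinkProb, Finset.Icc_eq_empty hi, Finset.sum_empty]

theorem expect_purifiedLaw (f : (Fin K → ℕ) → ℝ≥0∞) :
    expect S.purifiedLaw f = ∑ a ∈ S.linkStates, ENNReal.ofReal (S.purifiedProb a) * f a := by
  rw [expect, tsum_eq_sum (s := S.linkStates)]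
  · simp only [purifiedLaw_apply]
  · intro a ha
    by_contra h
    exact ha (S.mem_linkStates_of_pos (S.purifiedLaw_ne_zero.1 (left_ne_zero_of_mul h)))

/-! ### Service rates -/

/-- The service rate of the pair `e` when the allocation `π` is chosen with the weight `b a π` in
the state `a` of the links. -/
def serviceRate (b : (Fin K → ℕ) → (UserPair K → ℕ) → ℝ) (e : UserPair K) : ℝ :=
  ∑ a ∈ S.linkStates, S.purifiedProb a *
    ∑ π ∈ allocations a, b a π * ((S.q e : ℝ) * (π e : ℝ))

theorem le_of_mem_allocations {a : Fin K → ℕ} {π : UserPair K → ℕ} (h : π ∈ allocations a)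
    (e : UserPair K) : π e ≤ a e.1.1 :=
  le_trans (Finset.single_le_sum (f := π) (fun _ _ => Nat.zero_le _)
    (Finset.mem_filter.2 ⟨Finset.mem_univ e, Or.inl rfl⟩)) ((mem_allocations a π).1 h e.1.1)

theorem zero_mem_allocations (a : Fin K → ℕ) : (0 : UserPair K → ℕ) ∈ allocations a := by
  simp [mem_allocations, linkUse]

/-- Without entanglements only the zero allocation is feasible. -/
theorem serviceRate_eq_filter (b : (Fin K → ℕ) → (UserPair K → ℕ) → ℝ) (e : UserPair K) :
    S.serviceRate b e = ∑ a ∈ S.linkStates with a ≠ 0, S.purifiedProb a *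
      ∑ π ∈ allocations a, b a π * ((S.q e : ℝ) * (π e : ℝ)) := by
  symm
  refine Finset.sum_filter_of_ne fun a _ h => ?_
  rintro rfl
  refine h (mul_eq_zero_of_right _ (Finset.sum_eq_zero fun π hπ => ?_))
  have : π e = 0 := Nat.le_zero.1 (le_of_mem_allocations hπ e)
  simp [this]

theorem single_mem_allocations {a : Fin K → ℕ} (ha : ∀ i, 1 ≤ a i) (e : UserPair K) :
    Pi.single e 1 ∈ allocations a := by
  rw [mem_allocations]
  intro j
  refine le_trans ?_ (ha j)
  refine (Finset.sum_le_sum_of_subset (Finset.subset_univ _)).trans ?_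
  simp

theorem exists_purifiedProb_pos (hT : ∀ i, ∃ y : ℕ, 1 ≤ y ∧ 0 < S.purifiedLinkProb i y) :
    ∃ a : Fin K → ℕ, (∀ i, 1 ≤ a i) ∧ 0 < S.purifiedProb a := by
  choose a ha ha' using hT
  exact ⟨a, ha, Finset.prod_pos fun i _ => ha' i⟩

/-- Dividing by the sum increases every weight. The increase of the rate is strict for each pair `e`
since in a state of positive probability with an entanglement at every user the allocation of a
single swap to `e` is feasible and has positive weight. -/
theorem exists_normalized_weights (hq : ∀ e, 0 < (S.q e : ℝ))
    (hT : ∀ i, ∃ y : ℕ, 1 ≤ y ∧ 0 < S.purifiedLinkProb i y)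
    {b : (Fin K → ℕ) → (UserPair K → ℕ) → ℝ}
    (hb : ∀ a ∈ S.linkStates, ∀ π ∈ allocations a, 0 < b a π)
    (hb1 : ∀ a ∈ S.linkStates, ∑ π ∈ allocations a, b a π < 1) :
    ∃ b' : (Fin K → ℕ) → (UserPair K → ℕ) → ℝ,
      (∀ a ∈ S.linkStates, ∀ π ∈ allocations a, 0 ≤ b' a π) ∧
      (∀ a ∈ S.linkStates, ∑ π ∈ allocations a, b' a π = 1) ∧
      ∀ e, S.serviceRate b e < S.serviceRate b' e := by
  have hs : ∀ a ∈ S.linkStates, 0 < ∑ π ∈ allocations a, b a π := fun a ha =>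
    Finset.sum_pos (hb a ha) ⟨0, zero_mem_allocations a⟩
  have hlt : ∀ a ∈ S.linkStates, ∀ π ∈ allocations a,
      b a π < b a π / ∑ π ∈ allocations a, b a π := fun a ha π hπ => by
    rw [lt_div_iff₀ (hs a ha)]
    exact mul_lt_of_lt_one_right (hb a ha π hπ) (hb1 a ha)
  have hle : ∀ e, ∀ a ∈ S.linkStates, ∀ π ∈ allocations a, b a π * ((S.q e : ℝ) * (π e : ℝ))
      ≤ (b a π / ∑ π ∈ allocations a, b a π) * ((S.q e : ℝ) * (π e : ℝ)) := fun e a ha π hπ =>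
    mul_le_mul_of_nonneg_right (hlt a ha π hπ).le (mul_nonneg (hq e).le (Nat.cast_nonneg _))
  refine ⟨fun a π => b a π / ∑ π ∈ allocations a, b a π,
    fun a ha π hπ => div_nonneg (hb a ha π hπ).le (hs a ha).le,
    fun a ha => by rw [← Finset.sum_div, div_self (hs a ha).ne'], fun e => ?_⟩
  obtain ⟨a, ha1, ha⟩ := S.exists_purifiedProb_pos hT
  have ham := S.mem_linkStates_of_pos ha
  refine Finset.sum_lt_sum (fun a ha => mul_le_mul_of_nonneg_left
    (Finset.sum_le_sum (hle e a ha)) (S.purifiedProb_nonneg a)) ⟨a, ham, ?_⟩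
  refine mul_lt_mul_of_pos_left (Finset.sum_lt_sum (hle e a ham) ⟨Pi.single e 1,
    single_mem_allocations ha1 e, ?_⟩) ha
  refine mul_lt_mul_of_pos_right (hlt a ham _ (single_mem_allocations ha1 e)) ?_
  simpa using hq e

/-- The strict slack allows scaling the weights by `1 - ε` and spreading mass `ε / 2` evenly over
the allocations; the total is then at most `1 - ε / 2`. -/
theorem exists_positive_weights {lam : UserPair K → ℝ}
    {b : (Fin K → ℕ) → (UserPair K → ℕ) → ℝ}
    (hb : ∀ a ∈ S.linkStates, ∀ π ∈ allocations a, 0 ≤ b a π)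
    (hb1 : ∀ a ∈ S.linkStates, ∑ π ∈ allocations a, b a π ≤ 1)
    (hlam : ∀ e, lam e < S.serviceRate b e) :
    ∃ b' : (Fin K → ℕ) → (UserPair K → ℕ) → ℝ,
      (∀ a ∈ S.linkStates, ∀ π ∈ allocations a, 0 < b' a π) ∧
      (∀ a ∈ S.linkStates, ∑ π ∈ allocations a, b' a π < 1) ∧
      ∀ e, lam e ≤ S.serviceRate b' e := by
  have h1 : ∀ᶠ ε in 𝓝[>] (0 : ℝ), ∀ e, lam e < (1 - ε) * S.serviceRate b e := by
    rw [eventually_all]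
    intro e
    have : Tendsto (fun ε : ℝ => (1 - ε) * S.serviceRate b e) (𝓝[>] 0)
        (𝓝 ((1 - 0) * S.serviceRate b e)) :=
      ((continuous_const.sub continuous_id).mul continuous_const).continuousAt.tendsto.mono_left
        nhdsWithin_le_nhds
    rw [sub_zero, one_mul] at this
    exact this.eventually (lt_mem_nhds (hlam e))
  obtain ⟨ε, hε, hε0, hε1⟩ := (h1.and (Ioo_mem_nhdsGT (zero_lt_one (α := ℝ)))).exists
  have hcard : ∀ a : Fin K → ℕ, (0 : ℝ) < (allocations a).card := fun a => by
    exact_mod_cast Finset.card_pos.2 ⟨0, zero_mem_allocations a⟩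
  have hpos : ∀ a : Fin K → ℕ, 0 < ε / 2 / (allocations a).card := fun a =>
    div_pos (half_pos hε0) (hcard a)
  refine ⟨fun a π => (1 - ε) * b a π + ε / 2 / (allocations a).card, fun a ha π hπ => ?_,
    fun a ha => ?_, fun e => (hε e).le.trans ?_⟩
  · exact add_pos_of_nonneg_of_pos (mul_nonneg (sub_nonneg.2 hε1.le) (hb a ha π hπ)) (hpos a)
  · rw [Finset.sum_add_distrib, ← Finset.mul_sum, Finset.sum_const, nsmul_eq_mul,
      mul_div_cancel₀ _ (hcard a).ne']
    nlinarith [hb1 a ha]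
  · rw [serviceRate, serviceRate, Finset.mul_sum]
    refine Finset.sum_le_sum fun a ha => ?_
    rw [mul_left_comm, Finset.mul_sum]
    refine mul_le_mul_of_nonneg_left (Finset.sum_le_sum fun π _ => ?_) (S.purifiedProb_nonneg a)
    rw [← mul_assoc]
    exact mul_le_mul_of_nonneg_right (le_add_of_nonneg_right (hpos a).le)
      (mul_nonneg (S.q e).2.1 (Nat.cast_nonneg _))

/-! ### Stabilization by state-independent scheduling -/

variable {S}

theorem queueLaw_apply (A : UserPair K → PMF ℕ) (μ : Policy K) (x : UserPair K → ℕ) (n : ℕ)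
    (f : (UserPair K → ℕ) → ℝ≥0∞) :
    expect (S.queueLaw A μ x n) f = (kernelOp (S.step A μ))^[n] f x := by
  induction n generalizing f with
  | zero => exact expect_pure x f
  | succ n ih =>
    rw [queueLaw, expect_bind, Function.iterate_succ_apply, ← ih]
    rfl

/-- Once the allocation is fixed, swaps and arrivals are independent across pairs, so the step is a
product of single-queue steps. -/
theorem piPMF_serve (q : UserPair K → unitInterval) (A : UserPair K → PMF ℕ)
    (W Q : UserPair K → ℕ) :
    ((piPMF fun e => binomialPMF (min (W e) (Q e)) (q e)).bind fun D =>
        (piPMF A).map fun arrivals => fun e => Q e - D e + arrivals e)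
      = piPMF fun e => serve (q e) (A e) (W e) (Q e) := by
  have h1 : ∀ D : UserPair K → ℕ, ((piPMF A).map fun arrivals e => Q e - D e + arrivals e)
      = piPMF fun e => (A e).map fun a => Q e - D e + a := fun D =>
    piPMF_map A fun e a => Q e - D e + a
  simp only [h1]
  exact piPMF_bind _ fun e d => (A e).map fun a => Q e - d + a

theorem step_eq (A : UserPair K → PMF ℕ) (μ : Policy K) (Q : UserPair K → ℕ) :
    S.step A μ Q = S.purifiedLaw.bind fun t => (μ.select Q t).bind fun W =>
      piPMF fun e => serve (S.q e) (A e) (W e) (Q e) := by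
  simp only [step, piPMF_serve]

theorem isStable_of_tendsto {A : UserPair K → PMF ℕ} {μ : Policy K} {ν : PMF (UserPair K → ℕ)}
    (h : ∀ x y, Tendsto (fun n => S.queueLaw A μ x n y) atTop (𝓝 (ν y)))
    (hν : ∀ e, expect ν (fun x => (x e : ℝ≥0∞)) ≠ ∞) : S.IsStable A μ := by
  refine ⟨⟨ν.toMeasure, inferInstance⟩, fun x => tendsto_probabilityMeasure_of_tendsto_pmf (h x),
    fun e => ⟨(measurable_of_countable _).aestronglyMeasurable, ?_⟩⟩
  rw [HasFiniteIntegral, ProbabilityMeasure.coe_mk, lintegral_countable']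
  refine lt_top_iff_ne_top.2 ?_
  convert hν e using 1
  refine tsum_congr fun x => ?_
  rw [PMF.toMeasure_apply_singleton _ _ (measurableSet_singleton x), mul_comm]
  simp

open Classical in
/-- Service rates above the arrival rates stabilize the switch. -/
theorem stabilizable_of_lt_serviceRate (hq : ∀ e, 0 < (S.q e : ℝ))
    {A : UserPair K → PMF ℕ} {lam : UserPair K → ℝ} (hA : IsArrivalLaw A lam)
    {b : (Fin K → ℕ) → (UserPair K → ℕ) → ℝ}
    (hb : ∀ a ∈ S.linkStates, ∀ π ∈ allocations a, 0 ≤ b a π)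
    (hb1 : ∀ a ∈ S.linkStates, ∑ π ∈ allocations a, b a π = 1)
    (hlam : ∀ e, lam e < S.serviceRate b e) : S.Stabilizable A := by
  have hsel : ∀ a : Fin K → ℕ, ∃ s : PMF (UserPair K → ℕ), (∀ π ∈ s.support, π ∈ allocations a) ∧
      (a ∈ S.linkStates → ∀ g : (UserPair K → ℕ) → ℝ≥0∞,
        expect s g = ∑ π ∈ allocations a, ENNReal.ofReal (b a π) * g π) := by
    intro a
    by_cases ha : a ∈ S.linkStates
    · refine ⟨PMF.ofFinset (fun π => if π ∈ allocations a then ENNReal.ofReal (b a π) else 0)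
        (allocations a) ?_ fun π hπ => if_neg hπ, fun π hπ => ?_, fun _ g => ?_⟩
      · rw [Finset.sum_congr rfl fun π hπ => if_pos hπ,
          ← ENNReal.ofReal_sum_of_nonneg fun π hπ => hb a ha π hπ, hb1 a ha, ENNReal.ofReal_one]
      · by_contra h
        rw [PMF.mem_support_iff, PMF.ofFinset_apply] at hπ
        exact hπ (if_neg h)
      · rw [expect, tsum_eq_sum (s := allocations a)]
        · refine Finset.sum_congr rfl fun π hπ => ?_
          rw [PMF.ofFinset_apply, if_pos hπ]
        · intro π hπ
          rw [PMF.ofFinset_apply, if_neg hπ, zero_mul]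
    -- Nothing is known about the weights outside `linkStates`; these states have probability zero,
    -- so any feasible default will do.
    · refine ⟨PMF.pure 0, fun π hπ => ?_, fun h => absurd h ha⟩
      rw [PMF.mem_support_pure_iff] at hπ
      exact hπ ▸ zero_mem_allocations a
  choose s hs hse using hsel
  set μ : Policy K := ⟨fun _ a => s a, fun _ a => hs a⟩ with hμ
  have hstep : S.step A μ = networkStep S.q A (S.purifiedLaw.bind s) := by
    funext Q
    rw [step_eq, networkStep, PMF.bind_bind]
  have hN : ∀ W, S.purifiedLaw.bind s W ≠ 0 → ∀ e, W e ≤ S.alphaMax := by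
    intro W hW e
    obtain ⟨a, ha, haW⟩ := (PMF.mem_support_bind_iff _ _ _).1 hW
    exact (le_of_mem_allocations (hs a W haW) e).trans
      ((S.mem_linkStates).1 (S.mem_linkStates_of_pos (S.purifiedLaw_ne_zero.1 ha)) _)
  have hlt : ∀ e, expect (A e) (fun a => (a : ℝ≥0∞))
      < ENNReal.ofReal (S.q e : ℝ) * expect (S.purifiedLaw.bind s) fun W => (W e : ℝ≥0∞) := by
    intro e
    have hrate : ENNReal.ofReal (S.q e : ℝ) * expect (S.purifiedLaw.bind s) (fun W => (W e : ℝ≥0∞))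
        = ENNReal.ofReal (S.serviceRate b e) := by
      have hin : ∀ a ∈ S.linkStates, ∀ π ∈ allocations a,
          0 ≤ b a π * ((S.q e : ℝ) * (π e : ℝ)) := fun a ha π hπ =>
        mul_nonneg (hb a ha π hπ) (mul_nonneg (hq e).le (Nat.cast_nonneg _))
      rw [expect_bind, expect_purifiedLaw, serviceRate, Finset.mul_sum,
        ENNReal.ofReal_sum_of_nonneg fun a ha =>
          mul_nonneg (S.purifiedProb_nonneg a) (Finset.sum_nonneg (hin a ha))]
      refine Finset.sum_congr rfl fun a ha => ?_
      rw [hse a ha, ENNReal.ofReal_mul (S.purifiedProb_nonneg a),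
        ENNReal.ofReal_sum_of_nonneg (hin a ha), mul_left_comm, Finset.mul_sum]
      congr 1
      refine Finset.sum_congr rfl fun π hπ => ?_
      rw [ENNReal.ofReal_mul (hb a ha π hπ), ENNReal.ofReal_mul (hq e).le, ENNReal.ofReal_natCast]
      ring
    rw [hA.expect_eq, hrate]
    exact (ENNReal.ofReal_lt_ofReal_iff_of_nonneg (hA.nonneg e)).2 (hlam e)
  obtain ⟨ν, hν, hmean⟩ := exists_networkStep_limit hq hN hA.expect_sq_ne_top hlt
  refine ⟨μ, isStable_of_tendsto (ν := ν) (fun x y => ?_) hmean⟩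
  refine (hν x y).congr fun n => ?_
  rw [← hstep, ← queueLaw_apply]
  simp [expect]

end Switch

/-! ### Necessity: stationary laws of stable switches -/

/-- Weak convergence implies convergence of expectations of bounded functions on a discrete
space. -/
theorem tendsto_expect_of_tendsto {α : Type*} [MeasurableSpace α] [TopologicalSpace α]
    [DiscreteTopology α] [OpensMeasurableSpace α] [Countable α] [MeasurableSingletonClass α]
    {p : ℕ → PMF α} {ν : ProbabilityMeasure α}
    (h : Tendsto (β := ProbabilityMeasure α) (fun n => ⟨(p n).toMeasure, inferInstance⟩) atTop
      (𝓝 ν)) {f : α → ℝ≥0∞} (hf : ∀ x, f x ≤ 1) :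
    Tendsto (fun n => expect (p n) f) atTop (𝓝 (expect (ν : Measure α).toPMF f)) := by
  have hle : ∀ x, (f x).toNNReal ≤ 1 := fun x => by
    simpa using ENNReal.toNNReal_mono ENNReal.one_ne_top (hf x)
  have hcoe : ∀ x, ((f x).toNNReal : ℝ≥0∞) = f x := fun x =>
    ENNReal.coe_toNNReal (ne_top_of_le_ne_top ENNReal.one_ne_top (hf x))
  have h1 := ProbabilityMeasure.tendsto_iff_forall_lintegral_tendsto.1 h
    (BoundedContinuousFunction.mkOfDiscrete (fun x => (f x).toNNReal) 1 fun x y => by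
      rw [NNReal.dist_eq, abs_le]
      have hx : ((f x).toNNReal : ℝ) ≤ 1 := by exact_mod_cast hle x
      have hy : ((f y).toNNReal : ℝ) ≤ 1 := by exact_mod_cast hle y
      have hx0 := (f x).toNNReal.coe_nonneg
      have hy0 := (f y).toNNReal.coe_nonneg
      constructor <;> linarith)
  simp only [BoundedContinuousFunction.mkOfDiscrete_apply, hcoe, lintegral_countable',
    ProbabilityMeasure.coe_mk] at h1
  simpa only [expect, Measure.toPMF_apply, mul_comm,
    PMF.toMeasure_apply_singleton _ _ (measurableSet_singleton _)] using h1

theorem expect_serve_cast (q : unitInterval) (A : PMF ℕ) (w x : ℕ) :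
    expect (serve q A w x) (fun y => (y : ℝ≥0∞)) + ENNReal.ofReal (q : ℝ) * (min w x : ℕ)
      = x + expect A fun a => (a : ℝ≥0∞) := by
  rw [expect_serve, ← binomialPMF_mean, ← expect_add, ← expect_const (binomialPMF (min w x) q)
    (x + expect A fun a => (a : ℝ≥0∞))]
  refine expect_congr fun d hd => ?_
  have hd := le_of_binomialPMF_ne_zero hd
  push_cast
  rw [expect_add, expect_const, add_right_comm]
  congr 1
  have : x - d + d = x := by omega
  exact_mod_cast this

namespace Switch

variable {K : ℕ} {S : Switch K} {A : UserPair K → PMF ℕ} {μ : Policy K}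

/-- On a discrete space every kernel maps bounded functions to bounded continuous ones, so the weak
limit of the slot laws is invariant. -/
theorem IsStable.exists_stationary (h : S.IsStable A μ) :
    ∃ ν : PMF (UserPair K → ℕ), ν.bind (S.step A μ) = ν ∧
      (∀ x (f : (UserPair K → ℕ) → ℝ≥0∞), (∀ y, f y ≤ 1) →
        Tendsto (fun n => expect (S.queueLaw A μ x n) f) atTop (𝓝 (expect ν f))) ∧
      ∀ e, expect ν (fun x => (x e : ℝ≥0∞)) ≠ ∞ := by
  classical
  obtain ⟨ν, hν, hint⟩ := h
  have hlim : ∀ x (f : (UserPair K → ℕ) → ℝ≥0∞), (∀ y, f y ≤ 1) →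
      Tendsto (fun n => expect (S.queueLaw A μ x n) f) atTop
        (𝓝 (expect (ν : Measure (UserPair K → ℕ)).toPMF f)) := fun x f hf =>
    tendsto_expect_of_tendsto (hν x) hf
  refine ⟨(ν : Measure (UserPair K → ℕ)).toPMF, ?_, hlim, fun e => ?_⟩
  · ext y
    have hind : ∀ z : UserPair K → ℕ, (if z = y then (1 : ℝ≥0∞) else 0) ≤ 1 := fun z => by
      split_ifs <;> simp
    have h1 := (hlim 0 _ hind).comp (tendsto_add_atTop_nat 1)
    have h2 := hlim 0 (kernelOp (S.step A μ) fun z => if z = y then 1 else 0)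
      (kernelOp_iterate_le_one _ hind 1)
    have h3 := tendsto_nhds_unique h1 (h2.congr fun n => by
      rw [Function.comp_apply, queueLaw, expect_bind]
      rfl)
    have h4 := expect_bind (ν : Measure (UserPair K → ℕ)).toPMF (S.step A μ)
      fun z => if z = y then 1 else 0
    have h5 : ∀ p : PMF (UserPair K → ℕ), expect p (fun z => if z = y then 1 else 0) = p y :=
      fun p => by simp [expect]
    rw [h5] at h3 h4
    rw [h4, h3]
    rfl
  · have h1 := (hint e).2
    rw [HasFiniteIntegral, lintegral_countable'] at h1
    convert h1.ne using 1
    refine tsum_congr fun x => ?_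
    rw [Measure.toPMF_apply, mul_comm]
    simp

/-! ### Weighted queue lengths -/

/-- The weighted sum of the entries of a vector. -/
def weight (w : UserPair K → ℝ≥0∞) (x : UserPair K → ℕ) : ℝ≥0∞ := ∑ e, w e * x e

/-- The largest weighted expected number of successful swaps when the links are in the state `a`. -/
def maxService (S : Switch K) (w : UserPair K → ℝ≥0∞) (a : Fin K → ℕ) : ℝ≥0∞ :=
  (allocations a).sup fun π => ∑ e, w e * (ENNReal.ofReal (S.q e : ℝ) * π e)

theorem min_mem_allocations {a : Fin K → ℕ} {W : UserPair K → ℕ} (hW : W ∈ allocations a)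
    (x : UserPair K → ℕ) : (fun e => min (W e) (x e)) ∈ allocations a := by
  rw [mem_allocations] at hW ⊢
  exact fun j => (Finset.sum_le_sum fun e _ => min_le_left _ _).trans (hW j)

theorem le_maxService (S : Switch K) (w : UserPair K → ℝ≥0∞) {a : Fin K → ℕ}
    {W : UserPair K → ℕ} (hW : W ∈ allocations a) (x : UserPair K → ℕ) :
    ∑ e, w e * (ENNReal.ofReal (S.q e : ℝ) * (min (W e) (x e) : ℕ)) ≤ S.maxService w a :=
  Finset.le_sup (f := fun π : UserPair K → ℕ => ∑ e, w e * (ENNReal.ofReal (S.q e : ℝ) * π e))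
    (min_mem_allocations hW x)

theorem weight_mono (w : UserPair K → ℝ≥0∞) : Monotone (weight w) := fun _ _ h =>
  Finset.sum_le_sum fun e _ => mul_le_mul_right (Nat.cast_le.2 (h e)) _

theorem weight_add (w : UserPair K → ℝ≥0∞) (x y : UserPair K → ℕ) :
    weight w (fun e => x e + y e) = weight w x + weight w y := by
  simp only [weight, Nat.cast_add, mul_add, Finset.sum_add_distrib]

theorem weight_ne_top {w : UserPair K → ℝ≥0∞} (hw : ∀ e, w e ≠ ∞) (x : UserPair K → ℕ) :
    weight w x ≠ ∞ :=
  ENNReal.sum_ne_top.2 fun e _ => ENNReal.mul_ne_top (hw e) (by simp)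

theorem le_weight (w : UserPair K → ℝ≥0∞) (x : UserPair K → ℕ) (e : UserPair K) :
    w e * x e ≤ weight w x :=
  Finset.single_le_sum (f := fun e => w e * (x e : ℝ≥0∞)) (fun _ _ => zero_le) (Finset.mem_univ e)

theorem weight_sub_add {w : UserPair K → ℝ≥0∞} {x D a : UserPair K → ℕ} (hD : ∀ e, D e ≤ x e) :
    weight w (fun e => x e - D e + a e) + weight w D = weight w x + weight w a := by
  rw [← weight_add, ← weight_add]
  congr 1
  funext e
  have := hD e
  omega

theorem expect_weight (p : PMF (UserPair K → ℕ)) (w : UserPair K → ℝ≥0∞) :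
    expect p (weight w) = ∑ e, w e * expect p fun x => (x e : ℝ≥0∞) := by
  change expect p (fun x => ∑ e, w e * (x e : ℝ≥0∞)) = _
  rw [expect_finset_sum]
  simp only [expect_const_mul]

/-- A step of the queues, unfolded. -/
theorem step_apply_ne_zero {x W D a : UserPair K → ℕ} {t : Fin K → ℕ} (ht : S.purifiedLaw t ≠ 0) (hW : μ.select x t W ≠ 0)
    (hD : ∀ e, binomialPMF (min (W e) (x e)) (S.q e) (D e) ≠ 0) (ha : ∀ e, A e (a e) ≠ 0) :
    S.step A μ x (fun e => x e - D e + a e) ≠ 0 :=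
  bind_apply_ne_zero ht <| bind_apply_ne_zero hW <|
    bind_apply_ne_zero (piPMF_apply_ne_zero.2 hD) <|
      map_apply_ne_zero (fun (a : UserPair K → ℕ) e => x e - D e + a e) (piPMF_apply_ne_zero.2 ha)

theorem exists_of_step_apply_ne_zero {x y : UserPair K → ℕ} (h : S.step A μ x y ≠ 0) :
    ∃ (t : Fin K → ℕ) (W D a : UserPair K → ℕ), S.purifiedLaw t ≠ 0 ∧ μ.select x t W ≠ 0 ∧
      (∀ e, binomialPMF (min (W e) (x e)) (S.q e) (D e) ≠ 0) ∧ (∀ e, A e (a e) ≠ 0) ∧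
      y = fun e => x e - D e + a e := by
  obtain ⟨t, ht, h⟩ := (PMF.mem_support_bind_iff _ _ _).1 h
  obtain ⟨W, hW, h⟩ := (PMF.mem_support_bind_iff _ _ _).1 h
  obtain ⟨D, hD, h⟩ := (PMF.mem_support_bind_iff _ _ _).1 h
  obtain ⟨a, ha, h⟩ := (PMF.mem_support_map_iff _ _ _).1 h
  exact ⟨t, W, D, a, ht, hW, piPMF_apply_ne_zero.1 hD, piPMF_apply_ne_zero.1 ha, h.symm⟩

/-- If the weighted arrival rate is at least the largest weighted service rate, then the weighted
queue length does not decrease on average. -/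
theorem weight_le_expect_step {w : UserPair K → ℝ≥0∞} {Λ : ℝ≥0∞} (hΛ : Λ ≠ ∞)
    (hΛA : ∑ e, w e * expect (A e) (fun a => (a : ℝ≥0∞)) = Λ)
    (hmax : expect S.purifiedLaw (S.maxService w) ≤ Λ) (x : UserPair K → ℕ) :
    weight w x ≤ expect (S.step A μ x) (weight w) := by
  have h1 : ∀ W : UserPair K → ℕ,
      expect (piPMF fun e => serve (S.q e) (A e) (W e) (x e)) (weight w)
        + ∑ e, w e * (ENNReal.ofReal (S.q e : ℝ) * (min (W e) (x e) : ℕ)) = weight w x + Λ := by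
    intro W
    rw [expect_weight, ← hΛA, weight, ← Finset.sum_add_distrib, ← Finset.sum_add_distrib]
    refine Finset.sum_congr rfl fun e _ => ?_
    rw [expect_piPMF_eval _ e fun n => (n : ℝ≥0∞), ← mul_add, ← mul_add, expect_serve_cast]
  have h2 : weight w x + Λ ≤ expect (S.step A μ x) (weight w) + Λ := by
    calc weight w x + Λ ≤ expect S.purifiedLaw fun t => expect (μ.select x t) fun W =>
          expect (piPMF fun e => serve (S.q e) (A e) (W e) (x e)) (weight w)
            + S.maxService w t := by
          refine const_le_expect fun t _ => const_le_expect fun W hW => ?_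
          rw [← h1 W]
          gcongr
          exact le_maxService S w (μ.feasible x t W hW) x
      _ = expect (S.step A μ x) (weight w) + expect S.purifiedLaw (S.maxService w) := by
          rw [step_eq, expect_bind, ← expect_add]
          refine expect_congr fun t _ => ?_
          rw [expect_bind, expect_add, expect_const]
      _ ≤ _ := by gcongr
  exact (ENNReal.add_le_add_iff_right hΛ).1 h2

/-- A stable switch has, in every direction, a service rate in excess of the arrival rate. -/
theorem IsStable.lt_expect_maxService (h : S.IsStable A μ) (hq : ∀ e, 0 < (S.q e : ℝ))
    (hT : ∀ i, ∃ y : ℕ, 1 ≤ y ∧ 0 < S.purifiedLinkProb i y)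
    (hA : ∀ e, expect (A e) (fun a => (a : ℝ≥0∞)) ≠ ∞)
    {w : UserPair K → ℝ≥0∞} (hw : ∀ e, w e ≠ ∞) (hw0 : w ≠ 0) :
    ∑ e, w e * expect (A e) (fun a => (a : ℝ≥0∞)) < expect S.purifiedLaw (S.maxService w) := by
  classical
  by_contra hcon
  rw [not_lt] at hcon
  obtain ⟨Λ, hΛA⟩ : ∃ Λ, ∑ e, w e * expect (A e) (fun a => (a : ℝ≥0∞)) = Λ := ⟨_, rfl⟩
  rw [hΛA] at hcon
  have hΛ : Λ ≠ ∞ := hΛA ▸ ENNReal.sum_ne_top.2 fun e _ => ENNReal.mul_ne_top (hw e) (hA e)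
  obtain ⟨ν, hstat, hlim, hmean⟩ := h.exists_stationary
  have hVtop : expect ν (weight w) ≠ ∞ := by
    rw [expect_weight]
    exact ENNReal.sum_ne_top.2 fun e _ => ENNReal.mul_ne_top (hw e) (hmean e)
  -- The drift is nonnegative everywhere and, by stationarity and the finite mean, has average zero.
  have hdrift : ∀ x, ν x ≠ 0 → expect (S.step A μ x) (weight w) = weight w x := fun x hx => by
    refine eq_of_expect_le (g := fun x => expect (S.step A μ x) (weight w)) hVtop
      (fun x _ => weight_le_expect_step hΛ hΛA hcon x) ?_ hx
    rw [← expect_bind, hstat]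
  have hclosed : ∀ x y, ν x ≠ 0 → S.step A μ x y ≠ 0 → ν y ≠ 0 := fun x y hx hy => by
    rw [← hstat]
    exact bind_apply_ne_zero hx hy
  -- the states of minimal weight in the support of the stationary law
  have hpwo : (weight w '' {x | ν x ≠ 0}).IsPWO :=
    (Set.isPWO_of_wellQuasiOrderedLE _).image_of_monotone (weight_mono w)
  have hne : (weight w '' {x | ν x ≠ 0}).Nonempty := ν.support_nonempty.image _
  obtain ⟨x₀, hx₀, hc⟩ := hpwo.isWF.min_mem hne
  have hmin : ∀ x, ν x ≠ 0 → weight w x₀ ≤ weight w x := fun x hx => by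
    rw [hc]
    exact hpwo.isWF.min_le hne ⟨x, hx, rfl⟩
  -- From a state of minimal weight the next weight has that minimum as its mean and is never below
  -- it, hence equals it in every outcome.
  have hR : ∀ x y, ν x ≠ 0 → weight w x = weight w x₀ → S.step A μ x y ≠ 0 →
      ν y ≠ 0 ∧ weight w y = weight w x₀ := fun x y hx hxc hy => by
    refine ⟨hclosed x y hx hy, ?_⟩
    refine eq_of_expect_le (p := S.step A μ x) (f := fun _ => weight w x₀)
      (by rw [expect_const]; exact weight_ne_top hw x₀)
      (fun z hz => hmin z (hclosed x z hx hz)) ?_ hy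
    rw [expect_const, hdrift x hx, hxc]
  have hbal : ∀ x t W D a, ν x ≠ 0 → weight w x = weight w x₀ → S.purifiedLaw t ≠ 0 →
      μ.select x t W ≠ 0 → (∀ e, binomialPMF (min (W e) (x e)) (S.q e) (D e) ≠ 0) →
      (∀ e, A e (a e) ≠ 0) → weight w D = weight w a := by
    intro x t W D a hx hxc ht hW hD ha
    have h1 := (hR x _ hx hxc (step_apply_ne_zero ht hW hD ha)).2
    have h2 := weight_sub_add (w := w) (x := x) (D := D) (a := a) fun e =>
      (le_of_binomialPMF_ne_zero (hD e)).trans (min_le_right _ _)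
    rw [h1, ← hxc] at h2
    exact (ENNReal.add_right_inj (weight_ne_top hw x)).1 h2
  have hfull : ∀ x W : UserPair K → ℕ, ∀ e,
      binomialPMF (min (W e) (x e)) (S.q e) (min (W e) (x e)) ≠ 0 := fun x W e => by
    rw [binomialPMF_apply_self]
    exact pow_ne_zero _ (by simpa using hq e)
  -- the weight of the arrivals is constant
  have harr : ∀ a : UserPair K → ℕ, (∀ e, A e (a e) ≠ 0) → weight w a = Λ := by
    obtain ⟨t, ht⟩ := S.purifiedLaw.support_nonempty
    obtain ⟨W, hW⟩ := (μ.select x₀ t).support_nonempty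
    -- Arrivals are independent of services, so one possible service vector, with all attempts
    -- successful, balances every possible arrival vector.
    have h1 : ∀ a : UserPair K → ℕ, (∀ e, A e (a e) ≠ 0) →
        weight w a = weight w fun e => min (W e) (x₀ e) := fun a ha =>
      (hbal x₀ t W _ a hx₀ rfl ht hW (hfull x₀ W) ha).symm
    have h2 : expect (piPMF A) (weight w) = Λ := by
      rw [expect_weight, ← hΛA]
      exact Finset.sum_congr rfl fun e _ => by rw [expect_piPMF_eval A e fun n => (n : ℝ≥0∞)]
    have h3 : expect (piPMF A) (weight w) = weight w fun e => min (W e) (x₀ e) :=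
      (expect_congr fun a ha => h1 a (piPMF_apply_ne_zero.1 ha)).trans (expect_const _ _)
    exact fun a ha => (h1 a ha).trans (h3.symm.trans h2)
  have hAne : ∀ e, ∃ a, A e a ≠ 0 := fun e => (A e).support_nonempty
  choose a₀ ha₀ using hAne
  have hserv : ∀ x t W D, ν x ≠ 0 → weight w x = weight w x₀ → S.purifiedLaw t ≠ 0 →
      μ.select x t W ≠ 0 → (∀ e, binomialPMF (min (W e) (x e)) (S.q e) (D e) ≠ 0) →
      weight w D = Λ := fun x t W D hx hxc ht hW hD =>
    (hbal x t W D a₀ hx hxc ht hW hD ha₀).trans (harr a₀ ha₀)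
  -- pairs with random swaps are not served
  have hidle : ∀ x t W, ν x ≠ 0 → weight w x = weight w x₀ → S.purifiedLaw t ≠ 0 →
      μ.select x t W ≠ 0 → ∀ e, w e ≠ 0 → (S.q e : ℝ) < 1 → min (W e) (x e) = 0 := by
    intro x t W hx hxc ht hW e hwe hqe
    have h1 := hserv x t W _ hx hxc ht hW (hfull x W)
    -- For `0 < q e < 1` it is possible that all attempts succeed and also that exactly those of `e`
    -- fail; both outcomes must have weight `Λ`.
    have h2 := hserv x t W (Function.update (fun e => min (W e) (x e)) e 0) hx hxc ht hW
      fun i => by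
        by_cases hi : i = e
        · subst hi
          rw [Function.update_self, binomialPMF_apply_zero]
          exact pow_ne_zero _ (by simpa using hqe)
        · rw [Function.update_of_ne hi]
          exact hfull x W i
    rw [← h1] at h2
    have h3 : (fun e => min (W e) (x e)) = fun i =>
        Function.update (fun e => min (W e) (x e)) e 0 i
          + (Pi.single e (min (W e) (x e)) : UserPair K → ℕ) i := by
      funext i
      by_cases hi : i = e
      · subst hi; simp
      · simp [hi]
    conv_rhs at h2 => rw [h3, weight_add]
    have h4 : weight w (Pi.single e (min (W e) (x e))) = 0 :=
      (ENNReal.add_right_inj (weight_ne_top hw _)).1 (h2.symm.trans (add_zero _).symm)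
    have h5 := le_weight w (Pi.single e (min (W e) (x e))) e
    rw [h4, Pi.single_eq_same] at h5
    have h6 := (mul_eq_zero.1 (le_antisymm h5 zero_le)).resolve_left hwe
    exact_mod_cast h6
  -- At `x₀` the attempted swaps of weighted pairs succeed surely, so each possible link state
  -- allows a service of `Λ`; the average of the maxima is at most `Λ`, which forces equality.
  have hmaxt : ∀ t, S.purifiedLaw t ≠ 0 → S.maxService w t = Λ := by
    refine fun t ht => eq_of_expect_le (p := S.purifiedLaw) (f := fun _ => Λ)
      (by rwa [expect_const]) (fun t ht => ?_) (by rwa [expect_const]) ht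
    obtain ⟨W, hW⟩ := (μ.select x₀ t).support_nonempty
    rw [← hserv x₀ t W _ hx₀ rfl ht hW (hfull x₀ W)]
    refine le_trans (Finset.sum_le_sum fun e _ => ?_)
      (le_maxService S w (μ.feasible x₀ t W hW) x₀)
    by_cases hwe : w e = 0
    · simp [hwe]
    rcases (S.q e).2.2.lt_or_eq with hqe | hqe
    · simp only [hidle x₀ t W hx₀ rfl ht hW e hwe hqe, Nat.cast_zero, mul_zero, le_refl]
    · rw [hqe]
      simp
  have hnoarr : ∀ e, w e ≠ 0 → (S.q e : ℝ) < 1 → ∀ a, A e a ≠ 0 → a = 0 := by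
    intro e hwe hqe a ha
    by_contra ha0
    -- A positive arrival repeated in every slot makes this unserved queue grow without leaving the
    -- minimal states, so their weight would be unbounded.
    have hgrow : ∀ n : ℕ, ∃ x, ν x ≠ 0 ∧ weight w x = weight w x₀ ∧ n ≤ x e := by
      intro n
      induction n with
      | zero => exact ⟨x₀, hx₀, rfl, Nat.zero_le _⟩
      | succ n ih =>
        obtain ⟨x, hx, hxc, hn⟩ := ih
        obtain ⟨t, ht⟩ := S.purifiedLaw.support_nonempty
        obtain ⟨W, hW⟩ := (μ.select x t).support_nonempty
        have ha' : ∀ i, A i (Function.update a₀ e a i) ≠ 0 := fun i => by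
          by_cases hi : i = e
          · subst hi; rwa [Function.update_self]
          · rw [Function.update_of_ne hi]; exact ha₀ i
        obtain ⟨hy, hyc⟩ := hR x _ hx hxc (step_apply_ne_zero ht hW (hfull x W) ha')
        refine ⟨_, hy, hyc, ?_⟩
        simp only [hidle x t W hx hxc ht hW e hwe hqe, Function.update_self]
        omega
    obtain ⟨n, hn⟩ := ENNReal.exists_nat_mul_gt hwe (weight_ne_top hw x₀)
    obtain ⟨x, -, hxc, hx⟩ := hgrow n
    refine absurd hn (not_lt.2 ?_)
    rw [← hxc, mul_comm]
    exact le_trans (mul_le_mul_right (Nat.cast_le.2 hx) _) (le_weight w x e)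
  -- Otherwise no weighted pair is ever served at `x₀`, so `Λ = 0`, while a link state with an
  -- entanglement at every user permits service of positive weight.
  obtain ⟨e₁, hwe₁, hqe₁⟩ : ∃ e, w e ≠ 0 ∧ (S.q e : ℝ) = 1 := by
    by_contra! hall
    obtain ⟨e, he⟩ := Function.ne_iff.1 hw0
    obtain ⟨t, ht1, ht⟩ := S.exists_purifiedProb_pos hT
    have ht := S.purifiedLaw_ne_zero.2 ht
    have h1 : Λ = 0 := by
      obtain ⟨W, hW⟩ := (μ.select x₀ t).support_nonempty
      rw [← hserv x₀ t W _ hx₀ rfl ht hW (hfull x₀ W)]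
      refine Finset.sum_eq_zero fun i _ => ?_
      by_cases hwi : w i = 0
      · simp [hwi]
      · simp only [hidle x₀ t W hx₀ rfl ht hW i hwi ((S.q i).2.2.lt_of_ne (hall i hwi)),
          Nat.cast_zero, mul_zero]
    have h2 : w e * (ENNReal.ofReal (S.q e : ℝ) * 1) ≤ S.maxService w t := by
      refine le_trans ?_ (Finset.le_sup (f := fun π : UserPair K → ℕ =>
        ∑ e, w e * (ENNReal.ofReal (S.q e : ℝ) * π e)) (single_mem_allocations ht1 e))
      refine le_trans ?_ (Finset.single_le_sum (f := fun i => w i * (ENNReal.ofReal (S.q i : ℝ)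
        * ((Pi.single e 1 : UserPair K → ℕ) i : ℝ≥0∞))) (fun _ _ => zero_le) (Finset.mem_univ e))
      simp
    rw [hmaxt t ht, h1, mul_one, nonpos_iff_eq_zero, mul_eq_zero] at h2
    refine h2.elim he fun h => ?_
    exact absurd (hq e) (not_lt.2 (ENNReal.ofReal_eq_zero.1 h))
  -- a large initial queue of the pair `e₁` never decreases in weight
  obtain ⟨m, hm⟩ := ENNReal.exists_nat_mul_gt hwe₁ (weight_ne_top hw x₀)
  have hinv : ∀ n y, S.queueLaw A μ (Pi.single e₁ m) n y ≠ 0 →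
      weight w x₀ < weight w y ∧ ∀ e, w e ≠ 0 → (S.q e : ℝ) < 1 → y e = 0 := by
    intro n
    induction n with
    | zero =>
      intro y hy
      rw [queueLaw, ← PMF.mem_support_iff, PMF.mem_support_pure_iff] at hy
      subst hy
      refine ⟨hm.trans_le ?_, fun e _ hqe => Pi.single_eq_of_ne ?_ _⟩
      · have := le_weight w (Pi.single e₁ m) e₁
        rwa [Pi.single_eq_same, mul_comm] at this
      · rintro rfl
        exact hqe.ne hqe₁
    | succ n ih =>
      intro z hz
      obtain ⟨y, hy, hyz⟩ := (PMF.mem_support_bind_iff _ _ _).1 hz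
      obtain ⟨hyc, hy0⟩ := ih y hy
      obtain ⟨t, W, D, a, ht, hW, hD, ha, rfl⟩ := exists_of_step_apply_ne_zero hyz
      have hDle : ∀ e, D e ≤ min (W e) (y e) := fun e => le_of_binomialPMF_ne_zero (hD e)
      have h1 := weight_sub_add (w := w) (x := y) (D := D) (a := a) fun e =>
        (hDle e).trans (min_le_right _ _)
      -- All weighted services are at pairs with sure swaps, so the realized service is bounded by
      -- the maximal expected one.
      have h2 : weight w D ≤ Λ := by
        rw [← hmaxt t ht]
        refine le_trans (Finset.sum_le_sum fun e _ => ?_)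
          (le_maxService S w (μ.feasible y t W hW) y)
        by_cases hwe : w e = 0
        · simp [hwe]
        rcases (S.q e).2.2.lt_or_eq with hqe | hqe
        · have : D e = 0 := by
            have := hDle e
            rw [hy0 e hwe hqe] at this
            omega
          simp [this]
        · rw [hqe, ENNReal.ofReal_one, one_mul]
          exact mul_le_mul_right (Nat.cast_le.2 (hDle e)) _
      refine ⟨hyc.trans_le ?_, fun e hwe hqe => ?_⟩
      · refine (ENNReal.add_le_add_iff_right hΛ).1 ?_
        calc weight w y + Λ = weight w (fun e => y e - D e + a e) + weight w D := by
              rw [h1, harr a ha]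
          _ ≤ _ := by gcongr
      · simp only [hy0 e hwe hqe, hnoarr e hwe hqe _ (ha e), Nat.zero_sub]
  have hlim₀ := hlim (Pi.single e₁ m) (fun z => if z = x₀ then 1 else 0) fun z => by
    split_ifs <;> simp
  have hev : ∀ p : PMF (UserPair K → ℕ), expect p (fun z => if z = x₀ then 1 else 0) = p x₀ :=
    fun p => by simp [expect]
  simp only [hev] at hlim₀
  -- The limit law charges `x₀`, but from the heavy initial state `x₀` is never visited.
  refine hx₀ (tendsto_nhds_unique hlim₀ (tendsto_const_nhds.congr fun n => ?_))
  by_contra hne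
  exact lt_irrefl _ (hinv n x₀ (Ne.symm hne)).1

end Switch

/-- Every vector of nonnegative rates is the rate vector of some arrival laws. -/
theorem exists_isArrivalLaw {K : ℕ} {lam : UserPair K → ℝ} (h : 0 ≤ lam) :
    ∃ A : UserPair K → PMF ℕ, IsArrivalLaw A lam := by
  have key : ∀ r : ℝ, 0 ≤ r → ∃ p : PMF ℕ, HasSum (fun k : ℕ => (k : ℝ) * (p k).toReal) r ∧
      Summable fun k : ℕ => (k : ℝ) ^ 2 * (p k).toReal := by
    intro r hr
    set n := ⌊r⌋₊ with hn
    have h0 : 0 ≤ r - n := sub_nonneg.2 (Nat.floor_le hr)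
    have h1 : 0 ≤ 1 - (r - n) := by linarith [Nat.lt_floor_add_one r]
    -- The law on the two integers around `r` whose mean is `r`.
    set w : ℕ → ℝ := fun k => if k = n then 1 - (r - n) else if k = n + 1 then r - n else 0 with hw
    have hw0 : ∀ k, 0 ≤ w k := fun k => by
      simp only [hw]
      split_ifs <;> simp [h0, h1]
    have hwn : w n = 1 - (r - n) := if_pos rfl
    have hwn1 : w (n + 1) = r - n := by simp [hw]
    have hout : ∀ k ∉ ({n, n + 1} : Finset ℕ), w k = 0 := fun k hk => by
      simp only [Finset.mem_insert, Finset.mem_singleton, not_or] at hk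
      simp [hw, hk.1, hk.2]
    have hsum : ∀ g : ℕ → ℝ, ∑ k ∈ ({n, n + 1} : Finset ℕ), g k = g n + g (n + 1) := fun g =>
      Finset.sum_pair (by omega)
    refine ⟨PMF.ofFinset (fun k => ENNReal.ofReal (w k)) {n, n + 1} ?_
      fun k hk => by rw [hout k hk, ENNReal.ofReal_zero], ?_, ?_⟩
    · rw [← ENNReal.ofReal_sum_of_nonneg fun k _ => hw0 k, hsum, hwn, hwn1]
      simp
    · simp only [PMF.ofFinset_apply, ENNReal.toReal_ofReal (hw0 _)]
      have := hasSum_sum_of_ne_finset_zero (L := .unconditional ℕ)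
        (f := fun k : ℕ => (k : ℝ) * w k) (s := {n, n + 1})
        fun k hk => by rw [hout k hk, mul_zero]
      rw [hsum, hwn, hwn1] at this
      convert this using 1
      push_cast
      ring
    · simp only [PMF.ofFinset_apply, ENNReal.toReal_ofReal (hw0 _)]
      exact summable_of_ne_finset_zero (s := {n, n + 1}) fun k hk => by rw [hout k hk, mul_zero]
  choose A hA1 hA2 using fun e => key (lam e) (h e)
  exact ⟨A, hA1, hA2⟩

/-! ### Convex separation and the characterization of the region -/

namespace Switch

variable {K : ℕ} {S : Switch K}

/-- Weights that choose one allocation in each state of the links. -/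
def pickWeights (σ : (Fin K → ℕ) → UserPair K → ℕ) (a : Fin K → ℕ) (π : UserPair K → ℕ) : ℝ :=
  open Classical in if π = σ a then 1 else 0

theorem pickWeights_nonneg (σ : (Fin K → ℕ) → UserPair K → ℕ) (a : Fin K → ℕ)
    (π : UserPair K → ℕ) : 0 ≤ pickWeights σ a π := by
  unfold pickWeights
  split_ifs <;> simp

theorem sum_pickWeights_mul {σ : (Fin K → ℕ) → UserPair K → ℕ} (hσ : ∀ a, σ a ∈ allocations a)
    (a : Fin K → ℕ) (g : (UserPair K → ℕ) → ℝ) :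
    ∑ π ∈ allocations a, pickWeights σ a π * g π = g (σ a) := by
  classical
  rw [Finset.sum_eq_single (σ a)]
  · simp [pickWeights]
  · intro π _ hπ
    simp [pickWeights, hπ]
  · exact fun h => absurd (hσ a) h

theorem sum_pickWeights {σ : (Fin K → ℕ) → UserPair K → ℕ} (hσ : ∀ a, σ a ∈ allocations a)
    (a : Fin K → ℕ) : ∑ π ∈ allocations a, pickWeights σ a π = 1 := by
  simpa using sum_pickWeights_mul hσ a fun _ => 1

theorem serviceRate_combination (b b' : (Fin K → ℕ) → (UserPair K → ℕ) → ℝ) (s t : ℝ)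
    (e : UserPair K) :
    S.serviceRate (fun a π => s * b a π + t * b' a π) e
      = s * S.serviceRate b e + t * S.serviceRate b' e := by
  simp only [serviceRate, Finset.mul_sum, ← Finset.sum_add_distrib]
  exact Finset.sum_congr rfl fun a _ => Finset.sum_congr rfl fun π _ => by ring

/-- The rates that are strictly below the service rates of some randomized allocation. -/
def interiorRates (S : Switch K) : Set (UserPair K → ℝ) :=
  {c | ∃ b : (Fin K → ℕ) → (UserPair K → ℕ) → ℝ,
    (∀ a ∈ S.linkStates, ∀ π ∈ allocations a, 0 ≤ b a π) ∧
    (∀ a ∈ S.linkStates, ∑ π ∈ allocations a, b a π = 1) ∧ ∀ e, c e < S.serviceRate b e}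

theorem convex_interiorRates : Convex ℝ S.interiorRates := by
  rintro c ⟨b, hb, hb1, hc⟩ c' ⟨b', hb', hb1', hc'⟩ s t hs ht hst
  refine ⟨fun a π => s * b a π + t * b' a π, fun a ha π hπ =>
    add_nonneg (mul_nonneg hs (hb a ha π hπ)) (mul_nonneg ht (hb' a ha π hπ)), fun a ha => ?_,
    fun e => ?_⟩
  · rw [Finset.sum_add_distrib, ← Finset.mul_sum, ← Finset.mul_sum, hb1 a ha, hb1' a ha,
      mul_one, mul_one, hst]
  · rw [serviceRate_combination]
    simp only [Pi.add_apply, Pi.smul_apply, smul_eq_mul]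
    rcases hs.eq_or_lt with rfl | hs
    · have : t = 1 := by linarith
      subst this
      linarith [hc' e]
    · nlinarith [mul_lt_mul_of_pos_left (hc e) hs, mul_le_mul_of_nonneg_left (hc' e).le ht]

/-- Strict inequality for each pair makes the set a union of open orthants, one for each weight
system. -/
theorem isOpen_interiorRates : IsOpen S.interiorRates := by
  have h1 : S.interiorRates = ⋃ b ∈ {b : (Fin K → ℕ) → (UserPair K → ℕ) → ℝ |
      (∀ a ∈ S.linkStates, ∀ π ∈ allocations a, 0 ≤ b a π) ∧
      (∀ a ∈ S.linkStates, ∑ π ∈ allocations a, b a π = 1)},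
      Set.univ.pi fun e => Set.Iio (S.serviceRate b e) := by
    ext c
    simp [interiorRates, and_assoc]
  rw [h1]
  exact isOpen_biUnion fun b _ => isOpen_set_pi Set.finite_univ fun e _ => isOpen_Iio

theorem mem_interiorRates_of_neg {c : UserPair K → ℝ} (hc : ∀ e, c e < 0) :
    c ∈ S.interiorRates := by
  have h0 : ∀ a : Fin K → ℕ, (fun _ : Fin K → ℕ => (0 : UserPair K → ℕ)) a ∈ allocations a :=
    fun a => zero_mem_allocations a
  refine ⟨pickWeights fun _ => 0, fun a _ π _ => pickWeights_nonneg _ a π,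
    fun a _ => sum_pickWeights h0 a, fun e => ?_⟩
  have : S.serviceRate (pickWeights fun _ => 0) e = 0 := by
    refine Finset.sum_eq_zero fun a _ => ?_
    rw [sum_pickWeights_mul h0]
    simp
  rw [this]
  exact hc e

/-- The separating functional is nonnegative because `interiorRates` contains all negative vectors,
and nonzero because the separation is strict. -/
theorem exists_separating_weights {lam : UserPair K → ℝ} (h : lam ∉ S.interiorRates) :
    ∃ w : UserPair K → ℝ, 0 ≤ w ∧ w ≠ 0 ∧ ∀ b : (Fin K → ℕ) → (UserPair K → ℕ) → ℝ,
      (∀ a ∈ S.linkStates, ∀ π ∈ allocations a, 0 ≤ b a π) →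
      (∀ a ∈ S.linkStates, ∑ π ∈ allocations a, b a π = 1) →
      ∑ e, w e * S.serviceRate b e ≤ ∑ e, w e * lam e := by
  classical
  obtain ⟨f, hf⟩ := geometric_hahn_banach_open_point convex_interiorRates isOpen_interiorRates h
  have hfw : ∀ c : UserPair K → ℝ, f c = ∑ e, f (Pi.single e 1) * c e := fun c => by
    conv_lhs => rw [← Finset.univ_sum_single c, map_sum]
    refine Finset.sum_congr rfl fun e _ => ?_
    have : (Pi.single e (c e) : UserPair K → ℝ) = c e • Pi.single e 1 := by
      rw [← Pi.single_smul, smul_eq_mul, mul_one]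
    rw [this, map_smul, smul_eq_mul, mul_comm]
  refine ⟨fun e => f (Pi.single e 1), fun e => ?_, fun h0 => ?_, fun b hb hb1 => ?_⟩
  · by_contra hneg
    rw [Pi.zero_apply, not_le] at hneg
    -- If the coefficient of `e` were negative, lowering coordinate `e` indefinitely would make `f`
    -- unbounded above on the set.
    have h1 : ∀ s : ℝ, 0 ≤ s → f (-1) - s * f (Pi.single e 1) < f lam := fun s hs => by
      have := hf (-1 - s • Pi.single e 1) (mem_interiorRates_of_neg fun i => by
        by_cases hi : i = e
        · subst hi
          simp only [Pi.sub_apply, Pi.neg_apply, Pi.one_apply, Pi.smul_apply, Pi.single_eq_same,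
            smul_eq_mul, mul_one]
          linarith
        · simp [hi])
      rwa [map_sub, map_smul, smul_eq_mul] at this
    have h2 := h1 0 le_rfl
    have h3 := h1 ((f lam - f (-1)) / -f (Pi.single e 1))
      (div_nonneg (by linarith) (by linarith))
    have h4 : (f lam - f (-1)) / -f (Pi.single e 1) * f (Pi.single e 1) = -(f lam - f (-1)) := by
      field_simp [hneg.ne]
    linarith
  · have h1 := hf (-1) (mem_interiorRates_of_neg fun i => by simp)
    rw [hfw, hfw lam] at h1
    have h2 : ∀ e, f (Pi.single e 1) = 0 := fun e => congrFun h0 e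
    simp [h2] at h1
  -- The service rates lie only on the boundary; they are approached from inside by subtracting `ε`
  -- from each.
  · refine le_of_tendsto (f := fun ε : ℝ => ∑ e, f (Pi.single e 1) * (S.serviceRate b e - ε))
      (x := 𝓝[>] 0) ?_ ?_
    · have : Continuous fun ε : ℝ => ∑ e, f (Pi.single e 1) * (S.serviceRate b e - ε) := by
        fun_prop
      simpa using (this.tendsto 0).mono_left nhdsWithin_le_nhds
    · filter_upwards [self_mem_nhdsWithin] with ε hε
      have := hf (fun e => S.serviceRate b e - ε) ⟨b, hb, hb1, fun e => sub_lt_self _ hε⟩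
      rw [hfw, hfw lam] at this
      exact this.le

/-- The rates under which some policy is stable lie strictly below the service rates of some
randomized allocation. -/
theorem Stabilizable.mem_interiorRates {A : UserPair K → PMF ℕ} {lam : UserPair K → ℝ}
    (h : S.Stabilizable A) (hA : IsArrivalLaw A lam) (hq : ∀ e, 0 < (S.q e : ℝ))
    (hT : ∀ i, ∃ y : ℕ, 1 ≤ y ∧ 0 < S.purifiedLinkProb i y) : lam ∈ S.interiorRates := by
  obtain ⟨μ, hμ⟩ := h
  by_contra hlam
  obtain ⟨w, hw0, hwne, hw⟩ := exists_separating_weights hlam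
  have hA' : ∀ e, expect (A e) (fun a => (a : ℝ≥0∞)) ≠ ∞ := fun e => by
    rw [hA.expect_eq]; exact ENNReal.ofReal_ne_top
  have hne : (fun e => ENNReal.ofReal (w e)) ≠ 0 := fun h0 => hwne <| funext fun e =>
    le_antisymm (ENNReal.ofReal_eq_zero.1 (congrFun h0 e)) (hw0 e)
  refine absurd (hμ.lt_expect_maxService hq hT hA' (fun e => ENNReal.ofReal_ne_top) hne)
    (not_lt.2 ?_)
  -- The maximum over allocations is attained, so the expected maximal service is the weighted rate
  -- of a deterministic rule, to which the separation applies.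
  have hσ : ∀ a : Fin K → ℕ, ∃ π ∈ allocations a, S.maxService (fun e => ENNReal.ofReal (w e)) a
      = ∑ e, ENNReal.ofReal (w e) * (ENNReal.ofReal (S.q e : ℝ) * π e) := fun a =>
    Finset.exists_mem_eq_sup _ ⟨0, zero_mem_allocations a⟩ _
  choose σ hσ hmax using hσ
  have hq0 : ∀ a e, 0 ≤ w e * ((S.q e : ℝ) * (σ a e : ℝ)) := fun a e =>
    mul_nonneg (hw0 e) (mul_nonneg (hq e).le (Nat.cast_nonneg _))
  have h1 : ∀ a, S.maxService (fun e => ENNReal.ofReal (w e)) a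
      = ENNReal.ofReal (∑ e, w e * ((S.q e : ℝ) * (σ a e : ℝ))) := fun a => by
    rw [hmax, ENNReal.ofReal_sum_of_nonneg fun e _ => hq0 a e]
    refine Finset.sum_congr rfl fun e _ => ?_
    rw [ENNReal.ofReal_mul (hw0 e), ENNReal.ofReal_mul (hq e).le, ENNReal.ofReal_natCast]
  have h2 : expect S.purifiedLaw (S.maxService fun e => ENNReal.ofReal (w e))
      = ENNReal.ofReal (∑ e, w e * S.serviceRate (pickWeights σ) e) := by
    have h3 : ∑ e, w e * S.serviceRate (pickWeights σ) e
        = ∑ a ∈ S.linkStates, S.purifiedProb a * ∑ e, w e * ((S.q e : ℝ) * (σ a e : ℝ)) := by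
      simp only [serviceRate, sum_pickWeights_mul hσ, Finset.mul_sum]
      rw [Finset.sum_comm]
      exact Finset.sum_congr rfl fun a _ => Finset.sum_congr rfl fun e _ => by ring
    rw [expect_purifiedLaw, h3, ENNReal.ofReal_sum_of_nonneg fun a _ =>
      mul_nonneg (S.purifiedProb_nonneg a) (Finset.sum_nonneg fun e _ => hq0 a e)]
    refine Finset.sum_congr rfl fun a _ => ?_
    rw [h1, ENNReal.ofReal_mul (S.purifiedProb_nonneg a)]
  have h4 : ∑ e, ENNReal.ofReal (w e) * expect (A e) (fun a => (a : ℝ≥0∞))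
      = ENNReal.ofReal (∑ e, w e * lam e) := by
    rw [ENNReal.ofReal_sum_of_nonneg fun e _ => mul_nonneg (hw0 e) (hA.nonneg e)]
    exact Finset.sum_congr rfl fun e _ => by rw [hA.expect_eq, ENNReal.ofReal_mul (hw0 e)]
  rw [h2, h4]
  exact ENNReal.ofReal_le_ofReal (hw _ (fun a _ π _ => pickWeights_nonneg σ a π)
    fun a _ => sum_pickWeights hσ a)

theorem stabilizable_iff_mem_interiorRates {A : UserPair K → PMF ℕ} {lam : UserPair K → ℝ}
    (hA : IsArrivalLaw A lam) (hq : ∀ e, 0 < (S.q e : ℝ))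
    (hT : ∀ i, ∃ y : ℕ, 1 ≤ y ∧ 0 < S.purifiedLinkProb i y) :
    S.Stabilizable A ↔ lam ∈ S.interiorRates :=
  ⟨fun h => h.mem_interiorRates hA hq hT, fun ⟨_, hb, hb1, hlam⟩ =>
    stabilizable_of_lt_serviceRate hq hA hb hb1 hlam⟩

theorem mem_capacityRegion_iff {lam : UserPair K → ℝ} (hq : ∀ e, 0 < (S.q e : ℝ))
    (hT : ∀ i, ∃ y : ℕ, 1 ≤ y ∧ 0 < S.purifiedLinkProb i y) :
    lam ∈ S.capacityRegion ↔ 0 ≤ lam ∧ lam ∈ S.interiorRates := by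
  refine and_congr_right fun h0 => ⟨fun h => ?_, fun h A hA =>
    (stabilizable_iff_mem_interiorRates hA hq hT).2 h⟩
  -- A quantifier over all arrival laws gives information only if one with these rates exists.
  obtain ⟨A, hA⟩ := exists_isArrivalLaw h0
  exact (stabilizable_iff_mem_interiorRates hA hq hT).1 (h A hA)

theorem mem_interiorRates_iff {lam : UserPair K → ℝ} (hq : ∀ e, 0 < (S.q e : ℝ))
    (hT : ∀ i, ∃ y : ℕ, 1 ≤ y ∧ 0 < S.purifiedLinkProb i y) :
    lam ∈ S.interiorRates ↔ ∃ b : (Fin K → ℕ) → (UserPair K → ℕ) → ℝ,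
      (∀ a ∈ S.linkStates, ∀ π ∈ allocations a, 0 < b a π) ∧
      (∀ a ∈ S.linkStates, ∑ π ∈ allocations a, b a π < 1) ∧
      ∀ e, lam e ≤ S.serviceRate b e := by
  constructor
  · rintro ⟨b, hb, hb1, hlam⟩
    exact S.exists_positive_weights hb (fun a ha => (hb1 a ha).le) hlam
  · rintro ⟨b, hb, hb1, hlam⟩
    obtain ⟨b', hb', hb1', hlt⟩ := S.exists_normalized_weights hq hT hb hb1
    exact ⟨b', hb', hb1', fun e => (hlam e).trans_lt (hlt e)⟩

end Switch

end QuantumSwitch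

end

theorem theorem1 {K : ℕ} (S : QuantumSwitch.Switch K)
    (hq : ∀ e, 0 < (S.q e : ℝ))
    (hT : ∀ i, ∃ y : ℕ, 1 ≤ y ∧ 0 < S.purifiedLinkProb i y) :
    S.capacityRegion =
      {lam : QuantumSwitch.UserPair K → ℝ | 0 ≤ lam ∧
        ∃ b : (Fin K → ℕ) → (QuantumSwitch.UserPair K → ℕ) → ℝ,
          (∀ a ∈ S.linkStates, ∀ π ∈ QuantumSwitch.allocations a, 0 < b a π) ∧
          (∀ a ∈ S.linkStates, ∑ π ∈ QuantumSwitch.allocations a, b a π < 1) ∧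
          ∀ e, lam e ≤ ∑ a ∈ S.linkStates with a ≠ 0, S.purifiedProb a *
            ∑ π ∈ QuantumSwitch.allocations a, b a π * ((S.q e : ℝ) * (π e : ℝ))} ∧
    ∀ (A : QuantumSwitch.UserPair K → PMF ℕ) (lam : QuantumSwitch.UserPair K → ℝ),
      QuantumSwitch.IsArrivalLaw A lam → (S.Stabilizable A ↔ lam ∈ S.capacityRegion) := by
  refine ⟨Set.ext fun lam => ?_, fun A lam hA => ?_⟩
  · rw [QuantumSwitch.Switch.mem_capacityRegion_iff hq hT,
      QuantumSwitch.Switch.mem_interiorRates_iff hq hT]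
    simp only [QuantumSwitch.Switch.serviceRate_eq_filter]
    rfl
  · rw [QuantumSwitch.Switch.mem_capacityRegion_iff hq hT,
      QuantumSwitch.Switch.stabilizable_iff_mem_interiorRates hA hq hT, and_iff_right hA.nonneg]
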